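/- **Conventions.** Inner products are linear in one slot and conjugate-linear in the other; $[\mathfrak X,\mathfrak Y]$ denotes the bounded linear operators from $\mathfrak X$ to $\mathfrak Y$. Let $A$ be a closed symmetric operator in a complex Hilbert space $\mathfrak H$ (not necessarily densely defined), and let $\mathfrak H_0=\overline{\mathrm{dom}\,A}$. View $A$ as an operator from $\mathfrak H_0$ to $\mathfrak H$, with adjoint $A^*$ from $\mathfrak H$ to $\mathfrak H_0$. The rigged Hilbert space $\mathfrak H_+\subset\mathfrak H\subset\mathfrak H_-$ associated with $A$ consists of $\mathfrak H_+=\mathrm{dom}\,A^*$ with $(f,g)_+=(f,g)+(A^*f,A^*g)$ and its dual $\mathfrak H_-$. An operator $\mathbb D\in[\mathfrak H_+,\mathfrak H_-]$ is a *self-adjoint bi-extension* of $A$ if $A\subset\mathbb D=\mathbb D^*$ and $\{\{x,\mathbb Dx\}:x\in\mathfrak H_+,\ \mathbb Dx\in\mathfrak H\}$ is (the graph of) a self-adjoint extension of $A$ in $\mathfrak H$. $\Omega_A$ is the class of closed densely defined operators $T$ in $\mathfrak H$ with $A=T\cap T^*$ and with $-i$ a regular point of $T$. An operator $\mathbb A\in[\mathfrak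 H_+,\mathfrak H_-]$ is a *correct $(*)$-extension* of $T\in\Omega_A$ if $T\subset\mathbb A$, $T^*\subset\mathbb A^*$ and $\mathbb A_R=\frac12(\mathbb A+\mathbb A^*)$ is a self-adjoint bi-extension of $A$. A subspace $M$ *reduces* $A$ if $A$ is the orthogonal sum of its parts in $M$ and $M^\perp$. The operator $A$ is *prime* if there is no nonzero closed reducing subspace in which $A$ induces a self-adjoint operator. Let $\mathfrak E$ be a finite-dimensional Hilbert space. A system $(\mathbb D-zF_+)x=K\varphi_-$, $\varphi_+=K^*x$ is a *$\Delta_+$-system* if $\mathbb D$ is a self-adjoint bi-extension of the closed symmetric operator $A$, $K\in[\mathfrak E,\mathfrak H_-]$ is injective, $F_+$ is an orthogonal projection in $\mathfrak H_+$ and in $\mathfrak H$, and the set $\rho(\mathbb D,F_+,K)$ of all $z\in\mathbb C$ for which $(\mathbb D-zF_+)^{-1}$ exists on $\mathfrak H+\mathrm{ran}\,K$ and is continuous there from the norm of $\mathfrak H_-$ to the norm of $\mathfrak H$ is open. It is *minimal* if there is no nonzero subspace $\mathfrak H^1$ reducing $A$, of the form $\mathfrak H^1=\overline{\mathfrak H^1_+}$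 (closure in $\mathfrak H$) with $\mathfrak H^1_+$ a closed subspace of $\mathfrak H_+$ contained in $\mathrm{ran}\,F_+$, in which $A$ induces a self-adjoint operator. **Construction.** Let $V$ be a Herglotz–Nevanlinna function with values in $[\mathfrak E,\mathfrak E]$ and $$V(z)=Q+zL+\int_{\mathbb R}\Big(\frac1{t-z}-\frac t{1+t^2}\Big)d\Sigma(t),\qquad z\in\mathbb C\setminus\mathbb R,$$ where $Q=Q^*$, $L\ge0$, and $\Sigma$ is nondecreasing with $\int_{\mathbb R}(1+t^2)^{-1}(d\Sigma(t)x,x)<\infty$ for all $x\in\mathfrak E$. Choose: 1. $G=G^*\in[\mathfrak E,\mathfrak E]$ with $Gx=\int_{\mathbb R}\frac t{1+t^2}\,d\Sigma(t)x$ for all $x$ with $\int_{\mathbb R}(d\Sigma(t)x,x)<\infty$; 2. invertible self-adjoint $Q_1,Q_2$ with $Q_1+Q_2=Q-G$, invertible $K_1^{(1)},K_1^{(2)}\in[\mathfrak E,\mathfrak E]$, and put $D_1^{(i)}=K_1^{(i)}Q_i^{-1}K_1^{(i)*}$; 3. a closed symmetric operator $A_2$ in a Hilbert space $\mathfrak H_2$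 with rigged Hilbert space $\mathfrak H_{+2}\subset\mathfrak H_2\subset\mathfrak H_{-2}$, an operator $T_2\in\Omega_{A_2}$, a correct $(*)$-extension $\mathbb A^{(2)}$ of $T_2$, and $K_2\in[\mathfrak E,\mathfrak H_{-2}]$ with $\mathbb A^{(2)}-\mathbb A^{(2)*}=2iK_2K_2^*$ and $$K_2^*(\mathbb A_R^{(2)}-zI)^{-1}K_2=V(z)-Q-zL+G,\qquad z\in\mathbb C\setminus\mathbb R.$$ Let $P$ be the orthogonal projection onto $\overline{\mathrm{ran}}\,L$, and let $\widehat K$ be the operator equal to $I$ on $\ker L$ and to $L^{1/2}$ on $\overline{\mathrm{ran}}\,L$. In $\mathfrak H=\mathfrak E\oplus\mathfrak E\oplus\mathfrak E\oplus\mathfrak E\oplus\mathfrak H_2$, with the rigged Hilbert space of the symmetric operator $A=\begin{pmatrix}0&iI\\-iI&0\end{pmatrix}\oplus D_1^{(1)}\oplus D_1^{(2)}\oplus A_2$, put $$\mathbb D=\begin{pmatrix}0&iI\\-iI&0\end{pmatrix}\oplus D_1^{(1)}\oplus D_1^{(2)}\oplus\mathbb A_R^{(2)},\qquad F_+=\mathrm{diag}(0,I,0,0,I),\qquad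 K=\begin{pmatrix}P\widehat K\\ \widehat K\\ K_1^{(1)}\\ K_1^{(2)}\\ K_2\end{pmatrix}.$$ **Theorem.** For every such choice, the system given by $(A,\mathbb D,F_+,K)$ is a $\Delta_+$-system which realizes $V$, that is, $\mathbb C\setminus\mathbb R\subset\rho(\mathbb D,F_+,K)$ and $V(z)=K^*(\mathbb D-zF_+)^{-1}K$ for all $z\in\mathbb C\setminus\mathbb R$. This realization is minimal if and only if the symmetric operator $A_2$ is prime. -/

import Mathlib

open scoped ComplexConjugate InnerProductSpace

noncomputable section

namespace Impedance

/-! ### Rigged Hilbert spaces of a (not necessarily densely defined) operator -/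

section Rigged

variable {H : Type*} [NormedAddCommGroup H] [InnerProductSpace ℂ H]

/-- The closure `H₀` of the domain of `A`. -/
abbrev DomClosure (A : H →ₗ.[ℂ] H) : Submodule ℂ H := A.domain.topologicalClosure

/-- `A` regarded as a (densely defined) operator from `H₀` to `H`. -/
def onClosure (A : H →ₗ.[ℂ] H) : DomClosure A →ₗ.[ℂ] H where
  domain := A.domain.comap (DomClosure A).subtype
  toFun := A.toFun.comp
    (((DomClosure A).subtype.comp (A.domain.comap (DomClosure A).subtype).subtype).codRestrict
      A.domain (fun x => x.2))

lemma onClosure_apply (A : H →ₗ.[ℂ] H) (x : (onClosure A).domain) :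
    onClosure A x = A ⟨((x : DomClosure A) : H), x.2⟩ := rfl

lemma onClosure_dense (A : H →ₗ.[ℂ] H) :
    Dense ((onClosure A).domain : Set (DomClosure A)) := by
  rw [Metric.dense_iff]
  rintro ⟨x, hx⟩ r hr
  have hx' : x ∈ closure (A.domain : Set H) := hx
  obtain ⟨y, hy, hxy⟩ := Metric.mem_closure_iff.1 hx' r hr
  refine ⟨⟨y, subset_closure hy⟩, ?_, hy⟩
  rw [Metric.mem_ball, dist_comm]
  exact hxy

variable [CompleteSpace H]

/-- The adjoint `A*`, an operator from `H` to `H₀`, of `A` regarded as an operator from `H₀`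
to `H`. -/
def starOp (A : H →ₗ.[ℂ] H) : H →ₗ.[ℂ] DomClosure A := (onClosure A).adjoint

lemma starOp_mem_and_apply (A : H →ₗ.[ℂ] H) (y : H) (w : DomClosure A)
    (h : ∀ x : A.domain, ⟪(w : H), (x : H)⟫_ℂ = ⟪y, A x⟫_ℂ) :
    ∃ hy : y ∈ (starOp A).domain, starOp A ⟨y, hy⟩ = w := by
  have h' : ∀ x : (onClosure A).domain, ⟪w, (x : DomClosure A)⟫_ℂ = ⟪y, onClosure A x⟫_ℂ := by
    intro x
    exact h ⟨((x : DomClosure A) : H), x.2⟩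
  exact ⟨LinearPMap.mem_adjoint_domain_of_exists y ⟨w, h'⟩,
    LinearPMap.adjoint_apply_eq (onClosure_dense A) _ h'⟩

lemma starOp_inner (A : H →ₗ.[ℂ] H) (y : (starOp A).domain) (x : A.domain) :
    ⟪((starOp A y : DomClosure A) : H), (x : H)⟫_ℂ = ⟪(y : H), A x⟫_ℂ := by
  have := LinearPMap.adjoint_isFormalAdjoint (onClosure_dense A) y
    ⟨⟨(x : H), subset_closure x.2⟩, x.2⟩
  exact this

/-- The space `H₊ = dom A*` with the graph inner product `(f, g)₊ = (f, g) + (A* f, A* g)`. It is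
realized as the graph of `A*` in the Hilbert space `H ⊕ H₀`, `f` being identified with
`(f, A* f)`. -/
def HPlus (A : H →ₗ.[ℂ] H) : Type _ :=
  ((starOp A).graph.comap (WithLp.linearEquiv 2 ℂ (H × DomClosure A)).toLinearMap :
    Submodule ℂ (WithLp 2 (H × DomClosure A)))

instance (A : H →ₗ.[ℂ] H) : NormedAddCommGroup (HPlus A) :=
  inferInstanceAs (NormedAddCommGroup
    ((starOp A).graph.comap (WithLp.linearEquiv 2 ℂ (H × DomClosure A)).toLinearMap :
      Submodule ℂ (WithLp 2 (H × DomClosure A))))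

instance (A : H →ₗ.[ℂ] H) : InnerProductSpace ℂ (HPlus A) :=
  inferInstanceAs (InnerProductSpace ℂ
    ((starOp A).graph.comap (WithLp.linearEquiv 2 ℂ (H × DomClosure A)).toLinearMap :
      Submodule ℂ (WithLp 2 (H × DomClosure A))))

/-- The map `f ↦ (f, A* f)`. -/
def plusGraph (A : H →ₗ.[ℂ] H) : HPlus A →L[ℂ] WithLp 2 (H × DomClosure A) where
  toFun u := u.1
  map_add' _ _ := rfl
  map_smul' _ _ := rfl
  cont := continuous_subtype_val

/-- The inclusion `H₊ ⊂ H`. -/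
def incl (A : H →ₗ.[ℂ] H) : HPlus A →L[ℂ] H :=
  (WithLp.fstL 2 ℂ H (DomClosure A)).comp (plusGraph A)

/-- `A*` as a bounded operator from `H₊` to `H₀`. -/
def starPlus (A : H →ₗ.[ℂ] H) : HPlus A →L[ℂ] DomClosure A :=
  (WithLp.sndL 2 ℂ H (DomClosure A)).comp (plusGraph A)

/-- The element of `H₊` given by `f ∈ dom A*`. -/
def toPlus (A : H →ₗ.[ℂ] H) (f : (starOp A).domain) : HPlus A :=
  ⟨WithLp.toLp 2 ((f : H), starOp A f), (starOp A).mem_graph f⟩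

lemma incl_toPlus (A : H →ₗ.[ℂ] H) (f : (starOp A).domain) : incl A (toPlus A f) = f := rfl

lemma starPlus_toPlus (A : H →ₗ.[ℂ] H) (f : (starOp A).domain) :
    starPlus A (toPlus A f) = starOp A f := rfl

lemma plus_inner (A : H →ₗ.[ℂ] H) (f g : (starOp A).domain) :
    ⟪toPlus A f, toPlus A g⟫_ℂ = ⟪(f : H), (g : H)⟫_ℂ + ⟪starOp A f, starOp A g⟫_ℂ := rfl

lemma exists_toPlus (A : H →ₗ.[ℂ] H) (u : HPlus A) : ∃ f, toPlus A f = u := by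
  obtain ⟨f, hf, hf'⟩ := (LinearPMap.mem_graph_iff _).1 u.2
  refine ⟨f, Subtype.ext ((WithLp.linearEquiv 2 ℂ (H × DomClosure A)).injective ?_)⟩
  exact Prod.ext hf hf'

lemma starPlus_inner (A : H →ₗ.[ℂ] H) (u : HPlus A) (x : A.domain) :
    ⟪((starPlus A u : DomClosure A) : H), (x : H)⟫_ℂ = ⟪incl A u, A x⟫_ℂ := by
  obtain ⟨f, rfl⟩ := exists_toPlus A u
  exact starOp_inner A f x

/-- The space `H₋` of continuous conjugate-linear functionals on `H₊`; the value `φ u` is the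
pairing of `φ ∈ H₋` with `u ∈ H₊`, extending `(h, u) ↦ ⟪u, h⟫`. -/
abbrev HMinus (A : H →ₗ.[ℂ] H) : Type _ := HPlus A →L⋆[ℂ] ℂ

/-- Restriction of conjugate-linear functionals along a bounded operator. -/
def pullback {X Y : Type*} [NormedAddCommGroup X] [NormedSpace ℂ X]
    [NormedAddCommGroup Y] [NormedSpace ℂ Y] (p : X →L[ℂ] Y) : (Y →L⋆[ℂ] ℂ) →L[ℂ] (X →L⋆[ℂ] ℂ) :=
  (ContinuousLinearMap.compSL X Y ℂ (RingHom.id ℂ) (starRingEnd ℂ)).flip p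

/-- The inclusion `H ⊂ H₋`, sending `h` to the functional `u ↦ ⟪u, h⟫`. -/
def toMinus (A : H →ₗ.[ℂ] H) : H →L[ℂ] HMinus A :=
  (pullback (incl A)).comp (innerSLFlip ℂ)

/-- The adjoint `𝔸* ∈ [H₊, H₋]` of `𝔸 ∈ [H₊, H₋]`: `(𝔸* u, v) = (u, 𝔸 v)`. -/
def bAdjoint {A : H →ₗ.[ℂ] H} (B : HPlus A →L[ℂ] HMinus A) : HPlus A →L[ℂ] HMinus A :=
  LinearMap.mkContinuous₂
    (LinearMap.mk₂'ₛₗ (RingHom.id ℂ) (starRingEnd ℂ) (fun u v => conj (B v u))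
      (fun u₁ u₂ v => by simp only [map_add])
      (fun r u v => by simp)
      (fun u v₁ v₂ => by simp)
      (fun r u v => by simp)) ‖B‖
    (fun u v => by
      have := B.le_opNorm₂ v u
      simp only [LinearMap.mk₂'ₛₗ_apply, RCLike.norm_conj]
      linarith [mul_right_comm ‖B‖ ‖v‖ ‖u‖])

/-- The real part `𝔸_R = (𝔸 + 𝔸*) / 2`. -/
def bReal {A : H →ₗ.[ℂ] H} (B : HPlus A →L[ℂ] HMinus A) : HPlus A →L[ℂ] HMinus A :=
  (1 / 2 : ℂ) • (B + bAdjoint B)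

/-- `T ⊂ 𝔸` for an operator `T` in `H` and `𝔸 ∈ [H₊, H₋]`. -/
def Extends {A : H →ₗ.[ℂ] H} (T : H →ₗ.[ℂ] H) (B : HPlus A →L[ℂ] HMinus A) : Prop :=
  ∀ x : T.domain, ∃ u : HPlus A, incl A u = x ∧ B u = toMinus A (T x)

/-- The graph `{(x, 𝔸 x) : x ∈ H₊, 𝔸 x ∈ H}`, as a subspace of `H × H`. -/
def hatGraph {A : H →ₗ.[ℂ] H} (B : HPlus A →L[ℂ] HMinus A) : Submodule ℂ (H × H) where
  carrier := {p | ∃ u : HPlus A, incl A u = p.1 ∧ B u = toMinus A p.2}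
  zero_mem' := ⟨0, by simp, by simp⟩
  add_mem' := by
    rintro p q ⟨u, hu, hu'⟩ ⟨v, hv, hv'⟩
    exact ⟨u + v, by simp [hu, hv], by simp [hu', hv']⟩
  smul_mem' := by
    rintro r p ⟨u, hu, hu'⟩
    exact ⟨r • u, by simp [hu], by simp [hu']⟩

/-- `𝔸 ∈ [H₊, H₋]` is a self-adjoint bi-extension of `A`: it is a bi-extension (`A ⊂ 𝔸` and
`A ⊂ 𝔸*`), `𝔸 = 𝔸*`, and the part of `𝔸` in `H` is a self-adjoint extension of `A` in `H`. -/
structure IsSelfAdjointBiExtension (A : H →ₗ.[ℂ] H) (B : HPlus A →L[ℂ] HMinus A) : Prop where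
  extends_A : Extends A B
  extends_A' : Extends A (bAdjoint B)
  selfAdjoint : bAdjoint B = B
  hat_selfAdjoint : ∃ S : H →ₗ.[ℂ] H, S.graph = hatGraph B ∧ A ≤ S ∧ IsSelfAdjoint S

/-- `z` is a regular point of `T`: `T - z` is a bijection of `dom T` onto `H` with bounded
inverse. -/
def IsRegularPoint (T : H →ₗ.[ℂ] H) (z : ℂ) : Prop :=
  (∀ h : H, ∃! x : T.domain, T x - z • (x : H) = h) ∧
    ∃ c : ℝ, ∀ x : T.domain, ‖(x : H)‖ ≤ c * ‖T x - z • (x : H)‖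

/-- The class `Ω_A` of closed densely defined operators `T` with `A = T ∩ T*` and `-i` a regular
point of `T`. -/
structure ClassOmega (A T : H →ₗ.[ℂ] H) : Prop where
  closed : T.IsClosed
  dense : Dense (T.domain : Set H)
  inter : A.graph = T.graph ⊓ T.adjoint.graph
  regular : IsRegularPoint T (-Complex.I)

/-- `𝔸` is a correct `(*)`-extension of `T`: `T ⊂ 𝔸`, `T* ⊂ 𝔸*`, and the real part of `𝔸` is a
self-adjoint bi-extension of `A`. -/
structure IsCorrectStarExtension (A T : H →ₗ.[ℂ] H) (B : HPlus A →L[ℂ] HMinus A) : Prop where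
  extends_T : Extends T B
  extends_T' : Extends T.adjoint (bAdjoint B)
  correct : IsSelfAdjointBiExtension A (bReal B)

/-- `M` reduces `A`: `A` is the orthogonal sum of its parts in `M` and in `Mᗮ`. -/
def Reduces (A : H →ₗ.[ℂ] H) (M : Submodule ℂ H) : Prop :=
  ∀ x : A.domain, ∃ y z : A.domain, x = y + z ∧
    (y : H) ∈ M ∧ A y ∈ M ∧ (z : H) ∈ Mᗮ ∧ A z ∈ Mᗮ

/-- The operator that `A` induces in `M`: its domain is `{x ∈ dom A ∩ M : A x ∈ M}`. -/
def inducedOn (A : H →ₗ.[ℂ] H) (M : Submodule ℂ H) : M →ₗ.[ℂ] M where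
  domain :=
    { carrier := {x | ∃ h : (x : H) ∈ A.domain, A ⟨x, h⟩ ∈ M}
      zero_mem' := ⟨A.domain.zero_mem, by
        have : A 0 ∈ M := by rw [A.map_zero]; exact M.zero_mem
        exact this⟩
      add_mem' := by
        rintro x y ⟨hx, hx'⟩ ⟨hy, hy'⟩
        refine ⟨A.domain.add_mem hx hy, ?_⟩
        have := M.add_mem hx' hy'
        rwa [← A.map_add] at this
      smul_mem' := by
        rintro r x ⟨hx, hx'⟩
        refine ⟨A.domain.smul_mem r hx, ?_⟩
        have := M.smul_mem r hx'
        rwa [← A.map_smul] at this }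
  toFun :=
    { toFun := fun x => ⟨A ⟨((x : M) : H), x.2.1⟩, x.2.2⟩
      map_add' := fun x y => Subtype.ext (A.map_add ⟨_, x.2.1⟩ ⟨_, y.2.1⟩)
      map_smul' := fun r x => Subtype.ext (A.map_smul r ⟨_, x.2.1⟩) }

/-- `M` is a nonzero closed reducing subspace in which `A` induces a self-adjoint operator. -/
def IsSelfAdjointPart (A : H →ₗ.[ℂ] H) (M : Submodule ℂ H) : Prop :=
  ∃ _ : CompleteSpace M, M ≠ ⊥ ∧ Reduces A M ∧ IsSelfAdjoint (inducedOn A M)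

/-- `A` is prime: there is no nonzero reducing subspace in which it induces a self-adjoint
operator. -/
def IsPrime (A : H →ₗ.[ℂ] H) : Prop := ¬ ∃ M : Submodule ℂ H, IsSelfAdjointPart A M

/-! ### Impedance systems -/

variable {E : Type*} [NormedAddCommGroup E] [InnerProductSpace ℂ E] [CompleteSpace E]

/-- The adjoint `K* ∈ [H₊, E]` of `K ∈ [E, H₋]`. -/
def kAdjoint {A : H →ₗ.[ℂ] H} (K : E →L[ℂ] HMinus A) : HPlus A →L[ℂ] E :=
  ((InnerProductSpace.toDual ℂ E).symm.toContinuousLinearEquiv :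
    StrongDual ℂ E →L⋆[ℂ] E).comp K.flip

lemma kAdjoint_inner {A : H →ₗ.[ℂ] H} (K : E →L[ℂ] HMinus A) (u : HPlus A) (e : E) :
    ⟪kAdjoint K u, e⟫_ℂ = K e u := by
  simp [kAdjoint]

/-- The pencil `𝔻 - z F₊` from `H₊` to `H₋`, with `F` acting in `H`. -/
def pencil {A : H →ₗ.[ℂ] H} (D : HPlus A →L[ℂ] HMinus A) (F : H →L[ℂ] H) (z : ℂ) :
    HPlus A →L[ℂ] HMinus A :=
  D - z • ((toMinus A).comp (F.comp (incl A)))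

/-- `W = K* (𝔻 - z F₊)⁻¹ K`, where `(𝔻 - z F₊)⁻¹` exists on `ran K`. -/
def IsTransferValue {A : H →ₗ.[ℂ] H} (D : HPlus A →L[ℂ] HMinus A) (F : H →L[ℂ] H)
    (K : E →L[ℂ] HMinus A) (z : ℂ) (W : E →L[ℂ] E) : Prop :=
  ∀ e : E, ∃ u : HPlus A, pencil D F z u = K e ∧
    (∀ v : HPlus A, pencil D F z v = K e → v = u) ∧ W e = kAdjoint K u

variable (H E) in
/-- The data `(A, 𝔻, F₊, K)` of a system `(𝔻 - z F₊) x = K φ₋`, `φ₊ = K* x` in the rigged Hilbert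
space `H₊ ⊂ H ⊂ H₋` associated with `A`. The operator `F₊` is given through its action in `H`. -/
structure ImpedanceSystem where
  A : H →ₗ.[ℂ] H
  D : HPlus A →L[ℂ] HMinus A
  F : H →L[ℂ] H
  K : E →L[ℂ] HMinus A

namespace ImpedanceSystem

/-- The set `ρ(𝔻, F₊, K)` of points `z` such that `(𝔻 - z F₊)⁻¹` exists on the linear span of
`H ∪ ran K` and is continuous there from the norm of `H₋` to the norm of `H`. -/
def rho (S : ImpedanceSystem H E) : Set ℂ :=
  {z | Function.Injective (pencil S.D S.F z) ∧
    (∀ h : H, ∃ u, pencil S.D S.F z u = toMinus S.A h) ∧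
    (∀ e : E, ∃ u, pencil S.D S.F z u = S.K e) ∧
    ∃ c : ℝ, ∀ (u : HPlus S.A) (h : H) (e : E),
      pencil S.D S.F z u = toMinus S.A h + S.K e →
        ‖incl S.A u‖ ≤ c * ‖toMinus S.A h + S.K e‖}

/-- The defining properties of a `Δ₊`-system. -/
structure IsDeltaPlus (S : ImpedanceSystem H E) : Prop where
  closed : S.A.IsClosed
  symmetric : S.A.IsFormalAdjoint S.A
  biExtension : IsSelfAdjointBiExtension S.A S.D
  K_injective : Function.Injective S.K
  F_projection : S.F.toLinearMap.IsSymmetricProjection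
  F_plus_projection : ∃ F' : HPlus S.A →ₗ[ℂ] HPlus S.A,
    F'.IsSymmetricProjection ∧ ∀ u, incl S.A (F' u) = S.F (incl S.A u)
  rho_open : IsOpen S.rho

/-- The system realizes `V`: `V z = K* (𝔻 - z F₊)⁻¹ K` for all nonreal `z`, and all these `z`
belong to `ρ(𝔻, F₊, K)`. -/
def Realizes (S : ImpedanceSystem H E) (V : ℂ → E →L[ℂ] E) : Prop :=
  ∀ z : ℂ, z.im ≠ 0 → z ∈ S.rho ∧ IsTransferValue S.D S.F S.K z (V z)

/-- Minimality: there is no nonzero reducing subspace `M` of `H` in which `A` induces a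
self-adjoint operator and which is the closure in `H` of a closed subspace `N` of `H₊` contained in
`ran F₊`. -/
def IsMinimal (S : ImpedanceSystem H E) : Prop :=
  ¬ ∃ (M : Submodule ℂ H) (N : Submodule ℂ (HPlus S.A)),
    IsClosed (N : Set (HPlus S.A)) ∧
    (∀ u ∈ N, ∃ w : HPlus S.A, incl S.A u = S.F (incl S.A w)) ∧
    M = (N.map (incl S.A).toLinearMap).topologicalClosure ∧
    IsSelfAdjointPart S.A M

end ImpedanceSystem

end Rigged

/-! ### Herglotz-Nevanlinna functions -/

section Nevanlinna

variable {E : Type*} [NormedAddCommGroup E] [InnerProductSpace ℂ E] [CompleteSpace E]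

/-- `V` is holomorphic off the real line, `V(z)* = V(conj z)`, and `Im V(z) ≥ 0` for `Im z > 0`. -/
structure IsHerglotzNevanlinna (V : ℂ → E →L[ℂ] E) : Prop where
  holomorphic : DifferentiableOn ℂ V {z | z.im ≠ 0}
  symmetric : ∀ z : ℂ, z.im ≠ 0 → ContinuousLinearMap.adjoint (V z) = V (conj z)
  nonneg : ∀ z : ℂ, 0 < z.im → ∀ x : E, 0 ≤ (⟪x, V z x⟫_ℂ).im

lemma quad_monotone {S : ℝ → E →L[ℂ] E} (hS : Monotone S) (x : E) :
    Monotone fun t => (⟪x, S t x⟫_ℂ).re := by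
  intro s t hst
  have h : (S t - S s).IsPositive := (ContinuousLinearMap.le_def _ _).1 (hS hst)
  have h' := h.re_inner_nonneg_right x
  simp only [sub_apply, inner_sub_right, map_sub] at h'
  have h'' : 0 ≤ (⟪x, S t x⟫_ℂ).re - (⟪x, S s x⟫_ℂ).re := h'
  exact sub_nonneg.1 h''

/-- The measure `(dΣ(t) x, x)`. -/
def quadMeasure {S : ℝ → E →L[ℂ] E} (hS : Monotone S) (x : E) : MeasureTheory.Measure ℝ :=
  (quad_monotone hS x).stieltjesFunction.measure

/-- The sesquilinear integral of `f` over `(-N, N]` against `(dΣ(t) x, y)`, obtained from the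
measures `(dΣ(t) x, x)` by polarization; conjugate-linear in `y` and linear in `x`. -/
def truncatedForm {S : ℝ → E →L[ℂ] E} (hS : Monotone S) (f : ℝ → ℂ) (N : ℝ) (y x : E) : ℂ :=
  (1 / 4 : ℂ) * ∑ k ∈ Finset.range 4,
    Complex.I ^ k * ∫ t in Set.Ioc (-N) N, f t ∂(quadMeasure hS (x + Complex.I ^ k • y))

/-- `∫ f(t) dΣ(t) x = v`, the integral over the real line being the (weak) limit of the integrals
over `(-N, N]`. -/
def HasStieltjesIntegral {S : ℝ → E →L[ℂ] E} (hS : Monotone S) (f : ℝ → ℂ) (x v : E) : Prop :=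
  ∀ y : E, Filter.Tendsto (fun N : ℝ => truncatedForm hS f N y x) Filter.atTop (nhds ⟪y, v⟫_ℂ)

/-- An integral representation `V(z) = Q + z L + ∫ (1/(t - z) - t/(1 + t²)) dΣ(t)` for nonreal `z`,
with `Q = Q*`, `L ≥ 0`, and `Σ` nondecreasing with `∫ (dΣ(t) x, x) / (1 + t²) < ∞` for all `x`. -/
structure NevanlinnaRepresentation (V : ℂ → E →L[ℂ] E) where
  Q : E →L[ℂ] E
  L : E →L[ℂ] E
  Sig : ℝ → E →L[ℂ] E
  Q_selfAdjoint : IsSelfAdjoint Q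
  L_nonneg : 0 ≤ L
  Sig_mono : Monotone Sig
  Sig_integrable : ∀ x : E,
    MeasureTheory.Integrable (fun t : ℝ => 1 / (1 + t ^ 2)) (quadMeasure Sig_mono x)
  repr : ∀ z : ℂ, z.im ≠ 0 → ∀ x : E,
    HasStieltjesIntegral Sig_mono (fun t : ℝ => 1 / ((t : ℂ) - z) - (t : ℂ) / (1 + (t : ℂ) ^ 2)) x
      (V z x - Q x - z • L x)

end Nevanlinna

/-! ### Block operators -/

section Block

variable {E : Type*} [NormedAddCommGroup E] [InnerProductSpace ℂ E] [CompleteSpace E]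
variable {G : Type*} [NormedAddCommGroup G] [InnerProductSpace ℂ G] [CompleteSpace G]
variable {H₂ : Type*} [NormedAddCommGroup H₂] [InnerProductSpace ℂ H₂] [CompleteSpace H₂]

/-- The orthogonal sum `B ⊕ A₂` in `G ⊕ H₂` of a bounded operator `B` and an operator `A₂`. -/
def sumOp (B : G →L[ℂ] G) (A₂ : H₂ →ₗ.[ℂ] H₂) :
    WithLp 2 (G × H₂) →ₗ.[ℂ] WithLp 2 (G × H₂) where
  domain := A₂.domain.comap (WithLp.sndL 2 ℂ G H₂).toLinearMap
  toFun :=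
    { toFun := fun u => WithLp.toLp 2 (B (u : WithLp 2 (G × H₂)).fst,
        A₂ ⟨(u : WithLp 2 (G × H₂)).snd, u.2⟩)
      map_add' := fun u v => by
        rw [← WithLp.toLp_add, Prod.mk_add_mk, ← A₂.map_add, ← B.map_add]
        rfl
      map_smul' := fun r u => by
        rw [RingHom.id_apply, ← WithLp.toLp_smul, Prod.smul_mk, ← A₂.map_smul, ← B.map_smul]
        rfl }

lemma snd_mem_closure (B : G →L[ℂ] G) (A₂ : H₂ →ₗ.[ℂ] H₂) (w : DomClosure (sumOp B A₂)) :
    (w : WithLp 2 (G × H₂)).snd ∈ DomClosure A₂ :=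
  map_mem_closure (WithLp.sndL 2 ℂ G H₂).continuous w.2 (fun _ hx => hx)

lemma snd_plus (B : G →L[ℂ] G) (A₂ : H₂ →ₗ.[ℂ] H₂) (u : HPlus (sumOp B A₂)) :
    ((incl (sumOp B A₂) u).snd,
      (⟨((starPlus (sumOp B A₂) u : DomClosure (sumOp B A₂)) : WithLp 2 (G × H₂)).snd,
        snd_mem_closure B A₂ _⟩ : DomClosure A₂)) ∈ (starOp A₂).graph := by
  obtain ⟨hy, h⟩ := starOp_mem_and_apply A₂ (incl (sumOp B A₂) u).snd
    ⟨((starPlus (sumOp B A₂) u : DomClosure (sumOp B A₂)) : WithLp 2 (G × H₂)).snd,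
      snd_mem_closure B A₂ _⟩ (fun x => by
    have hx : WithLp.toLp 2 ((0 : G), (x : H₂)) ∈ (sumOp B A₂).domain := x.2
    have h := starPlus_inner (sumOp B A₂) u ⟨_, hx⟩
    have h1 : sumOp B A₂ ⟨_, hx⟩ = WithLp.toLp 2 (B 0, A₂ x) := rfl
    rw [h1, map_zero] at h
    simp only [WithLp.prod_inner_apply, inner_zero_right, zero_add] at h
    exact h)
  exact (LinearPMap.mem_graph_iff _).2 ⟨⟨_, hy⟩, rfl, h⟩

/-- The component in `H₊₂` of an element of the space `H₊` of `B ⊕ A₂`. -/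
def sndPlus (B : G →L[ℂ] G) (A₂ : H₂ →ₗ.[ℂ] H₂) : HPlus (sumOp B A₂) →L[ℂ] HPlus A₂ :=
  let p : HPlus (sumOp B A₂) →L[ℂ] WithLp 2 (H₂ × DomClosure A₂) :=
    (WithLp.prodContinuousLinearEquiv 2 ℂ H₂ (DomClosure A₂)).symm.toContinuousLinearMap.comp
      (((WithLp.sndL 2 ℂ G H₂).comp (incl (sumOp B A₂))).prod
        (ContinuousLinearMap.codRestrict ((WithLp.sndL 2 ℂ G H₂).comp
          ((DomClosure (sumOp B A₂)).subtypeL.comp (starPlus (sumOp B A₂))))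
          (DomClosure A₂) (fun _ => snd_mem_closure B A₂ _)))
  { toFun := fun u => ⟨p u, snd_plus B A₂ u⟩
    map_add' := fun u v => Subtype.ext (p.map_add u v)
    map_smul' := fun r u => Subtype.ext (p.map_smul r u)
    cont := p.continuous.subtype_mk _ }

lemma incl_sndPlus (B : G →L[ℂ] G) (A₂ : H₂ →ₗ.[ℂ] H₂) (u : HPlus (sumOp B A₂)) :
    incl A₂ (sndPlus B A₂ u) = (incl (sumOp B A₂) u).snd := rfl

/-- The component in `G` of an element of the space `H₊` of `B ⊕ A₂`. -/
def fstPlus (B : G →L[ℂ] G) (A₂ : H₂ →ₗ.[ℂ] H₂) : HPlus (sumOp B A₂) →L[ℂ] G :=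
  (WithLp.fstL 2 ℂ G H₂).comp (incl (sumOp B A₂))

/-- The orthogonal sum `B ⊕ 𝔸` from `H₊ = G ⊕ H₊₂` to `H₋ = G ⊕ H₋₂`. -/
def sumD (B : G →L[ℂ] G) {A₂ : H₂ →ₗ.[ℂ] H₂} (D : HPlus A₂ →L[ℂ] HMinus A₂) :
    HPlus (sumOp B A₂) →L[ℂ] HMinus (sumOp B A₂) :=
  (pullback (fstPlus B A₂)).comp ((innerSLFlip ℂ).comp (B.comp (fstPlus B A₂))) +
    (pullback (sndPlus B A₂)).comp (D.comp (sndPlus B A₂))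

lemma sumD_apply (B : G →L[ℂ] G) {A₂ : H₂ →ₗ.[ℂ] H₂} (D : HPlus A₂ →L[ℂ] HMinus A₂)
    (u v : HPlus (sumOp B A₂)) :
    sumD B D u v = ⟪fstPlus B A₂ v, B (fstPlus B A₂ u)⟫_ℂ +
      D (sndPlus B A₂ u) (sndPlus B A₂ v) := rfl

/-- The column operator from `E` to `H₋ = G ⊕ H₋₂` with entries `K₁` and `K₂`. -/
def colK (B : G →L[ℂ] G) {A₂ : H₂ →ₗ.[ℂ] H₂} (K₁ : E →L[ℂ] G) (K₂ : E →L[ℂ] HMinus A₂) :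
    E →L[ℂ] HMinus (sumOp B A₂) :=
  (pullback (fstPlus B A₂)).comp ((innerSLFlip ℂ).comp K₁) + (pullback (sndPlus B A₂)).comp K₂

lemma colK_apply (B : G →L[ℂ] G) {A₂ : H₂ →ₗ.[ℂ] H₂} (K₁ : E →L[ℂ] G) (K₂ : E →L[ℂ] HMinus A₂)
    (e : E) (v : HPlus (sumOp B A₂)) :
    colK B K₁ K₂ e v = ⟪fstPlus B A₂ v, K₁ e⟫_ℂ + K₂ e (sndPlus B A₂ v) := rfl

variable (H₂) in
/-- The operator `F ⊕ I` in `G ⊕ H₂`. -/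
def sumF (F : G →L[ℂ] G) : WithLp 2 (G × H₂) →L[ℂ] WithLp 2 (G × H₂) :=
  (WithLp.prodContinuousLinearEquiv 2 ℂ G H₂).symm.toContinuousLinearMap.comp
    ((F.comp (WithLp.fstL 2 ℂ G H₂)).prod (WithLp.sndL 2 ℂ G H₂))

variable (E) in
/-- The Hilbert space `E ⊕ E ⊕ E ⊕ E`. -/
abbrev E4 : Type _ := PiLp 2 (fun _ : Fin 4 => E)

/-- The operator into `E ⊕ E ⊕ E ⊕ E` with given components. -/
def into4 {X : Type*} [NormedAddCommGroup X] [NormedSpace ℂ X] (f : Fin 4 → X →L[ℂ] E) :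
    X →L[ℂ] E4 E :=
  (PiLp.continuousLinearEquiv 2 ℂ (fun _ : Fin 4 => E)).symm.toContinuousLinearMap.comp
    (ContinuousLinearMap.pi f)

variable (E) in
/-- The coordinate projections of `E ⊕ E ⊕ E ⊕ E`. -/
def coord (i : Fin 4) : E4 E →L[ℂ] E := PiLp.proj 2 (fun _ : Fin 4 => E) i

/-- The block matrix with diagonal blocks `((0, i I), (-i I, 0))`, `D₁`, `D₂`. -/
def block4 (D₁ D₂ : E →L[ℂ] E) : E4 E →L[ℂ] E4 E :=
  into4 ![Complex.I • coord E 1, -(Complex.I • coord E 0), D₁.comp (coord E 2),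
    D₂.comp (coord E 3)]

variable (E) in
/-- The block matrix `diag (0, I, 0, 0)`. -/
def proj4 : E4 E →L[ℂ] E4 E := into4 ![0, coord E 1, 0, 0]

end Block

/-! ### The realization -/

section Realization

variable {E : Type*} [NormedAddCommGroup E] [InnerProductSpace ℂ E] [CompleteSpace E]
variable {H₂ : Type*} [NormedAddCommGroup H₂] [InnerProductSpace ℂ H₂] [CompleteSpace H₂]

/-- The orthogonal projection onto the closure of the range of `L`. -/
def rangeProj (L : E →L[ℂ] E) : E →L[ℂ] E :=
  (LinearMap.range L.toLinearMap).topologicalClosure.starProjection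

/-- The operator equal to `I` on `ker L` and to `L^(1/2)` on the closure of `ran L`, for `L ≥ 0`. -/
def hatK (L : E →L[ℂ] E) : E →L[ℂ] E :=
  (1 - rangeProj L) + (CFC.sqrt L).comp (rangeProj L)

/-- The choices made in the construction of the realization of
`V(z) = Q + z L + ∫ (1/(t - z) - t/(1 + t²)) dΣ(t)`.

* `G = G*` with `G x = ∫ t/(1 + t²) dΣ(t) x` for all `x` with `∫ (dΣ(t) x, x) < ∞`;
* `Q - G = Q₁ + Q₂` with `Q₁`, `Q₂` self-adjoint and invertible, and invertible operators
  `K₁₁`, `K₁₂` in `E`;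
* a canonical scattering system with main operator `𝔸₂`, a correct `(*)`-extension of
  `T₂ ∈ Ω_{A₂}`, with `Im 𝔸₂ = K₂ K₂*`, whose impedance function `K₂* ((𝔸₂)_R - z)⁻¹ K₂` is
  `V₂(z) = G + ∫ (1/(t - z) - t/(1 + t²)) dΣ(t) = V(z) - Q - z L + G`. Injectivity of `K₂` is not
  required: it fails for every choice when `dΣ(t) x = 0` for some `x ≠ 0`. -/
structure Construction {V : ℂ → E →L[ℂ] E} (R : NevanlinnaRepresentation V) (H₂ : Type*)
    [NormedAddCommGroup H₂] [InnerProductSpace ℂ H₂] [CompleteSpace H₂] where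
  G : E →L[ℂ] E
  G_selfAdjoint : IsSelfAdjoint G
  G_integral : ∀ x : E, quadMeasure R.Sig_mono x Set.univ < ⊤ →
    HasStieltjesIntegral R.Sig_mono (fun t : ℝ => (t : ℂ) / (1 + (t : ℂ) ^ 2)) x (G x)
  Q₁ : (E →L[ℂ] E)ˣ
  Q₂ : (E →L[ℂ] E)ˣ
  Q₁_selfAdjoint : IsSelfAdjoint (Q₁ : E →L[ℂ] E)
  Q₂_selfAdjoint : IsSelfAdjoint (Q₂ : E →L[ℂ] E)
  Q_sum : (Q₁ : E →L[ℂ] E) + Q₂ = R.Q - G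
  K₁₁ : (E →L[ℂ] E)ˣ
  K₁₂ : (E →L[ℂ] E)ˣ
  A₂ : H₂ →ₗ.[ℂ] H₂
  A₂_closed : A₂.IsClosed
  A₂_symmetric : A₂.IsFormalAdjoint A₂
  T₂ : H₂ →ₗ.[ℂ] H₂
  T₂_mem : ClassOmega A₂ T₂
  AA₂ : HPlus A₂ →L[ℂ] HMinus A₂
  AA₂_extension : IsCorrectStarExtension A₂ T₂ AA₂
  K₂ : E →L[ℂ] HMinus A₂
  AA₂_im : ∀ u : HPlus A₂, AA₂ u - bAdjoint AA₂ u = (2 * Complex.I) • K₂ (kAdjoint K₂ u)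
  transfer : ∀ z : ℂ, z.im ≠ 0 →
    IsTransferValue (bReal AA₂) (ContinuousLinearMap.id ℂ H₂) K₂ z (V z - R.Q - z • R.L + G)

namespace Construction

variable {V : ℂ → E →L[ℂ] E} {R : NevanlinnaRepresentation V}

/-- The operator `D₁⁽¹⁾ = K₁₁ Q₁⁻¹ K₁₁*`. -/
def D₁ (c : Construction R H₂) : E →L[ℂ] E :=
  (c.K₁₁ : E →L[ℂ] E) * (↑c.Q₁⁻¹ : E →L[ℂ] E) * star (c.K₁₁ : E →L[ℂ] E)

/-- The operator `D₁⁽²⁾ = K₁₂ Q₂⁻¹ K₁₂*`. -/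
def D₂ (c : Construction R H₂) : E →L[ℂ] E :=
  (c.K₁₂ : E →L[ℂ] E) * (↑c.Q₂⁻¹ : E →L[ℂ] E) * star (c.K₁₂ : E →L[ℂ] E)

/-- The constructed system in the rigged Hilbert space of the symmetric operator
`A = ((0, i I), (-i I, 0)) ⊕ D₁⁽¹⁾ ⊕ D₁⁽²⁾ ⊕ A₂` in `E ⊕ E ⊕ E ⊕ E ⊕ H₂`, with
`𝔻 = ((0, i I), (-i I, 0)) ⊕ D₁⁽¹⁾ ⊕ D₁⁽²⁾ ⊕ (𝔸₂)_R`, `F₊ = diag (0, I, 0, 0, I)` and `K` the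
column `(P K̂, K̂, K₁₁, K₁₂, K₂)`. -/
def system (c : Construction R H₂) : ImpedanceSystem (WithLp 2 (E4 E × H₂)) E where
  A := sumOp (block4 c.D₁ c.D₂) c.A₂
  D := sumD (block4 c.D₁ c.D₂) (bReal c.AA₂)
  F := sumF H₂ (proj4 E)
  K := colK (block4 c.D₁ c.D₂)
    (into4 ![(rangeProj R.L).comp (hatK R.L), hatK R.L, (c.K₁₁ : E →L[ℂ] E),
      (c.K₁₂ : E →L[ℂ] E)]) c.K₂

end Construction

end Realization

end Impedance

end

open scoped ComplexConjugate InnerProductSpace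

set_option linter.unusedSectionVars false

noncomputable section

namespace Impedance

/-! ### Evaluation formulas in the rigged space. -/

section RiggedBasics

variable {H : Type*} [NormedAddCommGroup H] [InnerProductSpace ℂ H] [CompleteSpace H]

/-! The system is an orthogonal sum of a bounded self-adjoint block on `E4 E` and the canonical
system of `A₂`, and every claim is reduced to these two summands. The adjoint of `B ⊕ A₂` is `B ⊕
A₂*`, so `H₊` is the sum of the block space and `H₊₂` (`mkPlus`), `H₋` splits accordingly
(`sumMinus`), and `𝔻 - z F₊` is diagonal (`pencil_sum`).

On the block side the pencil is invertible for every complex `z`. Its upper left part has inverse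
`((z, i), (-i, 0))`; paired with the column `(P K̂, K̂)` the two imaginary terms cancel and `z K̂* P
K̂ = z L` remains, since `P K̂ = L^(1/2)`. The two remaining entries contribute `Q₁ + Q₂ = Q - G`.
Adding the transfer value `V(z) - Q - z L + G` of the second summand gives `V(z)`
(`inner_block4Inv_column`, `realizes`).

For the resolvent set, the self-adjoint operator inside the bi-extension makes `(𝔸_R - z)⁻¹` bounded
from `H₂` to `H₊₂` for nonreal `z` (`exists_pencil_eq`); by duality it is bounded from the norm of
`H₋₂` to that of `H₂` (`norm_incl_le`). Openness of `ρ` is a Neumann series argument valid for any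
system (`isOpen_rho`).

For minimality, let `M` be a self-adjoint part inside the range of `F₊`. The first component of `A
x` is `i` times the second component of `x`, and the range of `F₊` has zero first component; hence
the second component vanishes on the domain and, by density, on `M`. So `M` lies in `0 ⊕ H₂`
(`eq_zeroSum_of_le_range`), where `A` acts as `A₂` (`isSelfAdjointPart_zeroSum`), and each
self-adjoint part of `A₂` arises in this way. -/

lemma incl_injective (A : H →ₗ.[ℂ] H) : Function.Injective (incl A) := by
  intro u v h
  obtain ⟨f, rfl⟩ := exists_toPlus A u
  obtain ⟨g, rfl⟩ := exists_toPlus A v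
  rw [incl_toPlus, incl_toPlus] at h
  rw [Subtype.ext h]

lemma plus_inner_eq (A : H →ₗ.[ℂ] H) (u v : HPlus A) :
    ⟪u, v⟫_ℂ = ⟪incl A u, incl A v⟫_ℂ + ⟪starPlus A u, starPlus A v⟫_ℂ := rfl

lemma toMinus_apply (A : H →ₗ.[ℂ] H) (h : H) (u : HPlus A) :
    toMinus A h u = ⟪incl A u, h⟫_ℂ := rfl

lemma bAdjoint_apply {A : H →ₗ.[ℂ] H} (B : HPlus A →L[ℂ] HMinus A) (u v : HPlus A) :
    bAdjoint B u v = conj (B v u) := rfl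

lemma pencil_apply {A : H →ₗ.[ℂ] H} (D : HPlus A →L[ℂ] HMinus A) (F : H →L[ℂ] H) (z : ℂ)
    (u v : HPlus A) : pencil D F z u v = D u v - z * ⟪incl A v, F (incl A u)⟫_ℂ := rfl

lemma pencil_apply_eq_sub {A : H →ₗ.[ℂ] H} (D : HPlus A →L[ℂ] HMinus A) (F : H →L[ℂ] H) (z : ℂ)
    (u : HPlus A) : pencil D F z u = D u - z • toMinus A (F (incl A u)) := rfl

lemma unit_apply_inv_apply (U : (H →L[ℂ] H)ˣ) (x : H) :
    (U : H →L[ℂ] H) ((↑U⁻¹ : H →L[ℂ] H) x) = x :=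
  DFunLike.congr_fun U.mul_inv x

lemma unit_inv_apply_apply (U : (H →L[ℂ] H)ˣ) (x : H) :
    (↑U⁻¹ : H →L[ℂ] H) ((U : H →L[ℂ] H) x) = x :=
  DFunLike.congr_fun U.inv_mul x

end RiggedBasics

/-! ### Orthogonal sums: splitting of `H₊`, `H₋`, pencils and bi-extensions. -/

section Sum

variable {E : Type*} [NormedAddCommGroup E] [InnerProductSpace ℂ E] [CompleteSpace E]
variable {G : Type*} [NormedAddCommGroup G] [InnerProductSpace ℂ G] [CompleteSpace G]
variable {H₂ : Type*} [NormedAddCommGroup H₂] [InnerProductSpace ℂ H₂] [CompleteSpace H₂]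

lemma toLp_mem_domClosure (B : G →L[ℂ] G) (A₂ : H₂ →ₗ.[ℂ] H₂) (g : G) {h : H₂}
    (hh : h ∈ DomClosure A₂) :
    (WithLp.toLp 2 (g, h) : WithLp 2 (G × H₂)) ∈ DomClosure (sumOp B A₂) := by
  have hc : Continuous fun h : H₂ => (WithLp.toLp 2 (g, h) : WithLp 2 (G × H₂)) := by fun_prop
  exact map_mem_closure (f := fun h : H₂ => (WithLp.toLp 2 (g, h) : WithLp 2 (G × H₂))) hc hh
    (fun _ hx => hx)

/-- Self-adjointness of the bounded summand puts `B ⊕ A₂*` inside the adjoint of `B ⊕ A₂`. Together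
with `snd_plus` this identifies `H₊` with `G ⊕ H₊₂`. -/
lemma mkPlus_mem {B : G →L[ℂ] G} (hB : IsSelfAdjoint B) (A₂ : H₂ →ₗ.[ℂ] H₂) (g : G)
    (u : HPlus A₂) :
    ((WithLp.toLp 2 (g, incl A₂ u) : WithLp 2 (G × H₂)),
      (⟨WithLp.toLp 2 (B g, (starPlus A₂ u : H₂)),
        toLp_mem_domClosure B A₂ _ (starPlus A₂ u).2⟩ : DomClosure (sumOp B A₂))) ∈
      (starOp (sumOp B A₂)).graph := by
  obtain ⟨hy, h⟩ := starOp_mem_and_apply (sumOp B A₂) (WithLp.toLp 2 (g, incl A₂ u))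
    ⟨WithLp.toLp 2 (B g, (starPlus A₂ u : H₂)),
        toLp_mem_domClosure B A₂ _ (starPlus A₂ u).2⟩ (fun x => by
    have h1 : sumOp B A₂ x = WithLp.toLp 2 (B (x : WithLp 2 (G × H₂)).fst,
        A₂ ⟨(x : WithLp 2 (G × H₂)).snd, x.2⟩) := rfl
    rw [h1]
    simp only [WithLp.prod_inner_apply]
    have h2 := starPlus_inner A₂ u ⟨(x : WithLp 2 (G × H₂)).snd, x.2⟩
    have h3 : ⟪B g, (x : WithLp 2 (G × H₂)).fst⟫_ℂ = ⟪g, B (x : WithLp 2 (G × H₂)).fst⟫_ℂ :=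
      (ContinuousLinearMap.isSelfAdjoint_iff_isSymmetric.1 hB) _ _
    exact congrArg₂ (· + ·) h3 h2)
  exact (LinearPMap.mem_graph_iff _).2 ⟨⟨_, hy⟩, rfl, h⟩

/-- The element of the space `H₊` of `B ⊕ A₂` with given components, for `B = B*`. -/
def mkPlus {B : G →L[ℂ] G} (hB : IsSelfAdjoint B) (A₂ : H₂ →ₗ.[ℂ] H₂) :
    G × HPlus A₂ →L[ℂ] HPlus (sumOp B A₂) :=
  let e₁ := (WithLp.prodContinuousLinearEquiv 2 ℂ G H₂).symm.toContinuousLinearMap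
  let p : G × HPlus A₂ →L[ℂ] WithLp 2 (WithLp 2 (G × H₂) × DomClosure (sumOp B A₂)) :=
    (WithLp.prodContinuousLinearEquiv 2 ℂ (WithLp 2 (G × H₂))
      (DomClosure (sumOp B A₂))).symm.toContinuousLinearMap.comp
      ((e₁.comp ((ContinuousLinearMap.id ℂ G).prodMap (incl A₂))).prod
        (ContinuousLinearMap.codRestrict
          (e₁.comp (B.prodMap ((DomClosure A₂).subtypeL.comp (starPlus A₂))))
          (DomClosure (sumOp B A₂))
          (fun w => toLp_mem_domClosure B A₂ _ (starPlus A₂ w.2).2)))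
  { toFun := fun w => ⟨p w, mkPlus_mem hB A₂ w.1 w.2⟩
    map_add' := fun u v => Subtype.ext (p.map_add u v)
    map_smul' := fun r u => Subtype.ext (p.map_smul r u)
    cont := p.continuous.subtype_mk _ }

variable {B : G →L[ℂ] G} (hB : IsSelfAdjoint B) {A₂ : H₂ →ₗ.[ℂ] H₂}

lemma incl_mkPlus (w : G × HPlus A₂) :
    incl (sumOp B A₂) (mkPlus hB A₂ w) = WithLp.toLp 2 (w.1, incl A₂ w.2) := rfl

lemma starPlus_mkPlus (w : G × HPlus A₂) :
    ((starPlus (sumOp B A₂) (mkPlus hB A₂ w) : DomClosure (sumOp B A₂)) : WithLp 2 (G × H₂)) =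
      WithLp.toLp 2 (B w.1, (starPlus A₂ w.2 : H₂)) := rfl

@[simp] lemma fstPlus_mkPlus (w : G × HPlus A₂) : fstPlus B A₂ (mkPlus hB A₂ w) = w.1 := rfl

@[simp] lemma sndPlus_mkPlus (w : G × HPlus A₂) : sndPlus B A₂ (mkPlus hB A₂ w) = w.2 := rfl

lemma mkPlus_fst_snd (u : HPlus (sumOp B A₂)) :
    mkPlus hB A₂ (fstPlus B A₂ u, sndPlus B A₂ u) = u :=
  incl_injective _ rfl

/-- The summand `G` carries the graph inner product of `B`, not its own. Orthogonality of `F₊` in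
`H₊` is therefore a condition on `B` as well. -/
lemma mkPlus_inner (w w' : G × HPlus A₂) :
    ⟪mkPlus hB A₂ w, mkPlus hB A₂ w'⟫_ℂ =
      ⟪w.1, w'.1⟫_ℂ + ⟪B w.1, B w'.1⟫_ℂ + ⟪w.2, w'.2⟫_ℂ := by
  rw [plus_inner_eq, plus_inner_eq, incl_mkPlus, incl_mkPlus, Submodule.coe_inner,
    Submodule.coe_inner, starPlus_mkPlus, starPlus_mkPlus]
  simp only [WithLp.prod_inner_apply]
  ring

variable (B) in
/-- The element of `H₋ = G ⊕ H₋₂` with given components. -/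
def sumMinus (a : G) (φ : HMinus A₂) : HMinus (sumOp B A₂) :=
  pullback (fstPlus B A₂) (innerSLFlip ℂ a) + pullback (sndPlus B A₂) φ

lemma sumMinus_apply (a : G) (φ : HMinus A₂) (v : HPlus (sumOp B A₂)) :
    sumMinus B a φ v = ⟪fstPlus B A₂ v, a⟫_ℂ + φ (sndPlus B A₂ v) := rfl

lemma sumMinus_mkPlus (a : G) (φ : HMinus A₂) (w : G × HPlus A₂) :
    sumMinus B a φ (mkPlus hB A₂ w) = ⟪w.1, a⟫_ℂ + φ w.2 := rfl

include hB in
lemma sumMinus_inj {a a' : G} {φ φ' : HMinus A₂} :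
    sumMinus B a φ = sumMinus B a' φ' ↔ a = a' ∧ φ = φ' := by
  refine ⟨fun h => ⟨ext_inner_left ℂ fun g => ?_, ContinuousLinearMap.ext fun u => ?_⟩, ?_⟩
  · simpa [sumMinus_mkPlus] using DFunLike.congr_fun h (mkPlus hB A₂ (g, 0))
  · simpa [sumMinus_mkPlus] using DFunLike.congr_fun h (mkPlus hB A₂ (0, u))
  · rintro ⟨rfl, rfl⟩
    rfl

include hB in
-- Composing a functional with the bounded map `mkPlus` recovers its two components, so the constant
-- is `‖mkPlus‖`.
lemma sumMinus_bound : ∃ c : ℝ, 0 ≤ c ∧ ∀ (a : G) (φ : HMinus A₂),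
    ‖a‖ ≤ c * ‖sumMinus B a φ‖ ∧ ‖φ‖ ≤ c * ‖sumMinus B a φ‖ := by
  have hc : 0 ≤ ‖mkPlus hB A₂‖ := ContinuousLinearMap.opNorm_nonneg _
  refine ⟨‖mkPlus hB A₂‖, hc, fun a φ => ?_⟩
  have key : ∀ w : G × HPlus A₂, ‖⟪w.1, a⟫_ℂ + φ w.2‖ ≤
      ‖mkPlus hB A₂‖ * ‖sumMinus B a φ‖ * ‖w‖ := fun w => by
    rw [← sumMinus_mkPlus hB]
    calc _ ≤ ‖sumMinus B a φ‖ * ‖mkPlus hB A₂ w‖ := ContinuousLinearMap.le_opNorm _ _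
      _ ≤ ‖sumMinus B a φ‖ * (‖mkPlus hB A₂‖ * ‖w‖) := by
        gcongr
        exact ContinuousLinearMap.le_opNorm _ _
      _ = _ := by ring
  constructor
  -- Testing at `a` itself gives `‖a‖²` on the left; one factor `‖a‖` is then cancelled.
  · have h := key (a, 0)
    simp only [map_zero, add_zero, inner_self_eq_norm_sq_to_K, Prod.norm_mk, norm_zero] at h
    rw [max_eq_left (norm_nonneg a)] at h
    rcases (norm_nonneg a).eq_or_lt with h0 | h0
    · rw [← h0]
      positivity
    · refine le_of_mul_le_mul_right ?_ h0
      simpa [pow_two] using h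
  · refine ContinuousLinearMap.opNorm_le_bound _ (by positivity) fun u => ?_
    simpa using key (0, u)

lemma toMinus_sumOp (h : WithLp 2 (G × H₂)) :
    toMinus (sumOp B A₂) h = sumMinus B h.fst (toMinus A₂ h.snd) := rfl

lemma sumD_eq (D : HPlus A₂ →L[ℂ] HMinus A₂) (u : HPlus (sumOp B A₂)) :
    sumD B D u = sumMinus B (B (fstPlus B A₂ u)) (D (sndPlus B A₂ u)) := rfl

lemma colK_eq (K₁ : E →L[ℂ] G) (K₂ : E →L[ℂ] HMinus A₂) (e : E) :
    colK B K₁ K₂ e = sumMinus B (K₁ e) (K₂ e) := rfl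

/-- Since `F ⊕ I` is diagonal too, the pencil decouples, and invertibility and estimates can be
studied on each summand. -/
lemma pencil_sum (D : HPlus A₂ →L[ℂ] HMinus A₂) (F : G →L[ℂ] G) (z : ℂ)
    (u : HPlus (sumOp B A₂)) :
    pencil (sumD B D) (sumF H₂ F) z u =
      sumMinus B ((B - z • F) (fstPlus B A₂ u))
        (pencil D (ContinuousLinearMap.id ℂ H₂) z (sndPlus B A₂ u)) := by
  ext v
  have h : (⟪incl (sumOp B A₂) v, sumF H₂ F (incl (sumOp B A₂) u)⟫_ℂ) =
      ⟪fstPlus B A₂ v, F (fstPlus B A₂ u)⟫_ℂ +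
        ⟪incl A₂ (sndPlus B A₂ v), incl A₂ (sndPlus B A₂ u)⟫_ℂ := rfl
  rw [pencil_apply, sumMinus_apply, pencil_apply, sumD_apply, h]
  simp only [sub_apply, smul_apply, inner_sub_right, inner_smul_right,
    ContinuousLinearMap.id_apply]
  ring

include hB in
lemma bAdjoint_sumD (D : HPlus A₂ →L[ℂ] HMinus A₂) :
    bAdjoint (sumD B D) = sumD B (bAdjoint D) := by
  ext u v
  rw [bAdjoint_apply, sumD_apply, sumD_apply, bAdjoint_apply, map_add, inner_conj_symm]
  congr 1
  exact (ContinuousLinearMap.isSelfAdjoint_iff_isSymmetric.1 hB) _ _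

lemma sumOp_apply (T : H₂ →ₗ.[ℂ] H₂) (x : (sumOp B T).domain) :
    sumOp B T x = WithLp.toLp 2 (B (x : WithLp 2 (G × H₂)).fst,
        T ⟨(x : WithLp 2 (G × H₂)).snd, x.2⟩) := rfl

include hB in
lemma Extends.sumD {T : H₂ →ₗ.[ℂ] H₂} {D : HPlus A₂ →L[ℂ] HMinus A₂} (h : Extends T D) :
    Extends (sumOp B T) (sumD B D) := by
  intro x
  obtain ⟨u, hu, hu'⟩ := h ⟨(x : WithLp 2 (G × H₂)).snd, x.2⟩
  refine ⟨mkPlus hB A₂ ((x : WithLp 2 (G × H₂)).fst, u), ?_, ?_⟩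
  · rw [incl_mkPlus, hu]
    rfl
  · rw [sumD_eq, toMinus_sumOp, fstPlus_mkPlus, sndPlus_mkPlus, hu']
    rfl

lemma mem_sumOp_graph {T : H₂ →ₗ.[ℂ] H₂} {p : WithLp 2 (G × H₂) × WithLp 2 (G × H₂)} :
    p ∈ (sumOp B T).graph ↔ p.2.fst = B p.1.fst ∧ (p.1.snd, p.2.snd) ∈ T.graph := by
  simp only [LinearPMap.mem_graph_iff]
  constructor
  · rintro ⟨x, hx, hx'⟩
    rw [← hx, ← hx']
    exact ⟨rfl, ⟨(x : WithLp 2 (G × H₂)).snd, x.2⟩, rfl, rfl⟩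
  · rintro ⟨h, x, hx, hx'⟩
    have hm : p.1.snd ∈ T.domain := by
      have := x.2
      rwa [hx] at this
    obtain rfl : x = ⟨p.1.snd, hm⟩ := Subtype.ext hx
    refine ⟨⟨p.1, hm⟩, rfl, ?_⟩
    rw [sumOp_apply]
    refine (WithLp.equiv 2 (G × H₂)).injective (Prod.ext h.symm hx')

include hB in
lemma mem_hatGraph_sumD {D : HPlus A₂ →L[ℂ] HMinus A₂}
    {p : WithLp 2 (G × H₂) × WithLp 2 (G × H₂)} :
    p ∈ hatGraph (sumD B D) ↔ p.2.fst = B p.1.fst ∧ (p.1.snd, p.2.snd) ∈ hatGraph D := by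
  constructor
  · rintro ⟨u, hu, hu'⟩
    rw [sumD_eq, toMinus_sumOp, sumMinus_inj hB] at hu'
    rw [← hu]
    exact ⟨hu'.1.symm, sndPlus B A₂ u, rfl, hu'.2⟩
  · rintro ⟨h, u, hu, hu'⟩
    refine ⟨mkPlus hB A₂ (p.1.fst, u), ?_, ?_⟩
    · rw [incl_mkPlus, hu]
      rfl
    · rw [sumD_eq, toMinus_sumOp, fstPlus_mkPlus, sndPlus_mkPlus, hu', h]

include hB in
lemma sumOp_symmetric {T : H₂ →ₗ.[ℂ] H₂} (hT : T.IsFormalAdjoint T) :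
    (sumOp B T).IsFormalAdjoint (sumOp B T) := by
  intro x y
  rw [sumOp_apply, sumOp_apply]
  simp only [WithLp.prod_inner_apply]
  exact congrArg₂ (· + ·) ((ContinuousLinearMap.isSelfAdjoint_iff_isSymmetric.1 hB) _ _)
    (hT ⟨_, x.2⟩ ⟨_, y.2⟩)

lemma sumOp_isClosed {T : H₂ →ₗ.[ℂ] H₂} (hT : T.IsClosed) : (sumOp B T).IsClosed := by
  have h : ((sumOp B T).graph : Set (WithLp 2 (G × H₂) × WithLp 2 (G × H₂))) =
      {p | p.2.fst = B p.1.fst} ∩ (fun p => (p.1.snd, p.2.snd)) ⁻¹' (T.graph : Set (H₂ × H₂)) := by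
    ext p
    exact mem_sumOp_graph
  have h1 : Continuous fun p : WithLp 2 (G × H₂) × WithLp 2 (G × H₂) => p.2.fst :=
    (WithLp.fstL 2 ℂ G H₂).continuous.comp continuous_snd
  have h2 : Continuous fun p : WithLp 2 (G × H₂) × WithLp 2 (G × H₂) => p.1.fst :=
    (WithLp.fstL 2 ℂ G H₂).continuous.comp continuous_fst
  have h3 : Continuous fun p : WithLp 2 (G × H₂) × WithLp 2 (G × H₂) => p.2.snd :=
    (WithLp.sndL 2 ℂ G H₂).continuous.comp continuous_snd
  have h4 : Continuous fun p : WithLp 2 (G × H₂) × WithLp 2 (G × H₂) => p.1.snd :=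
    (WithLp.sndL 2 ℂ G H₂).continuous.comp continuous_fst
  change _root_.IsClosed ((sumOp B T).graph : Set (WithLp 2 (G × H₂) × WithLp 2 (G × H₂)))
  rw [h]
  exact (isClosed_eq h1 (B.continuous.comp h2)).inter (IsClosed.preimage (h4.prodMk h3) hT)

include hB in
lemma sumOp_isSelfAdjoint {T : H₂ →ₗ.[ℂ] H₂} (hT : IsSelfAdjoint T) :
    IsSelfAdjoint (sumOp B T) := by
  have hd : Dense (T.domain : Set H₂) := hT.dense_domain
  have hTs : T.IsFormalAdjoint T := by
    have := LinearPMap.adjoint_isFormalAdjoint hd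
    rwa [LinearPMap.isSelfAdjoint_def.1 hT] at this
  have hd' : Dense ((sumOp B T).domain : Set (WithLp 2 (G × H₂))) := fun x =>
    toLp_mem_domClosure B T x.fst (hd x.snd)
  rw [LinearPMap.isSelfAdjoint_def]
  have hle := (sumOp_symmetric hB hTs).le_adjoint hd'
  refine (LinearPMap.eq_of_le_of_domain_eq hle (le_antisymm hle.1 fun y hy => ?_)).symm
  change y.snd ∈ T.domain
  rw [← LinearPMap.isSelfAdjoint_def.1 hT]
  refine LinearPMap.mem_adjoint_domain_of_exists _
    ⟨((sumOp B T).adjoint ⟨y, hy⟩).snd, fun x => ?_⟩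
  -- Test vectors with zero first component isolate the adjoint condition for `T`.
  have hx : (WithLp.toLp 2 ((0 : G), (x : H₂)) : WithLp 2 (G × H₂)) ∈ (sumOp B T).domain := x.2
  have := LinearPMap.adjoint_isFormalAdjoint hd' ⟨y, hy⟩ ⟨_, hx⟩
  rw [sumOp_apply] at this
  simpa [WithLp.prod_inner_apply] using this

include hB in
lemma IsSelfAdjointBiExtension.sumD {D : HPlus A₂ →L[ℂ] HMinus A₂}
    (h : IsSelfAdjointBiExtension A₂ D) :
    IsSelfAdjointBiExtension (sumOp B A₂) (sumD B D) where
  extends_A := h.extends_A.sumD hB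
  extends_A' := by
    rw [bAdjoint_sumD hB]
    exact h.extends_A'.sumD hB
  selfAdjoint := by rw [bAdjoint_sumD hB, h.selfAdjoint]
  hat_selfAdjoint := by
    obtain ⟨S, hS, hAS, hSa⟩ := h.hat_selfAdjoint
    refine ⟨sumOp B S, ?_, ?_, sumOp_isSelfAdjoint hB hSa⟩
    · ext p
      rw [mem_sumOp_graph, mem_hatGraph_sumD hB, hS]
    · refine LinearPMap.le_of_le_graph fun p hp => ?_
      rw [mem_sumOp_graph] at hp ⊢
      exact ⟨hp.1, LinearPMap.le_graph_of_le hAS hp.2⟩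

end Sum

/-! ### Resolvents: openness of `ρ`, and estimates for self-adjoint bi-extensions. -/

section Resolvent

variable {H : Type*} [NormedAddCommGroup H] [InnerProductSpace ℂ H] [CompleteSpace H]
variable {E : Type*} [NormedAddCommGroup E] [InnerProductSpace ℂ E] [CompleteSpace E]

lemma pencil_eq_pencil_sub {A : H →ₗ.[ℂ] H} (D : HPlus A →L[ℂ] HMinus A) (F : H →L[ℂ] H)
    (z z₀ : ℂ) (u : HPlus A) :
    pencil D F z u = pencil D F z₀ u - (z - z₀) • toMinus A (F (incl A u)) := by
  ext v
  rw [sub_apply, pencil_apply, pencil_apply, smul_apply, toMinus_apply, smul_eq_mul]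
  ring

/-- The set `ρ(𝔻, F₊, K)` is open, by a Neumann series for `(𝔻 - z F₊)⁻¹` on `H`. -/
lemma ImpedanceSystem.isOpen_rho (S : ImpedanceSystem H E) : IsOpen S.rho := by
  rw [Metric.isOpen_iff]
  rintro z₀ ⟨hinj, hH, hK, c, hc⟩
  -- `r` is the resolvent at `z₀` restricted to `H`, with values in `H₊`. The hypothesis bounds it
  -- only in the norm of `H`, so the Neumann series is run in `H` and its result is lifted back to
  -- `H₊`.
  choose r hr using hH
  have hr_add : ∀ g h, r (g + h) = r g + r h := fun g h => hinj (by simp [hr])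
  have hr_smul : ∀ (a : ℂ) h, r (a • h) = a • r h := fun a h => hinj (by simp [hr])
  have hr_bound : ∀ h, ‖incl S.A (r h)‖ ≤ |c| * ‖toMinus S.A‖ * ‖h‖ := fun h => by
    have h1 := hc (r h) h 0 (by simp [hr])
    rw [map_zero, add_zero] at h1
    calc _ ≤ c * ‖toMinus S.A h‖ := h1
      _ ≤ |c| * ‖toMinus S.A h‖ := by gcongr; exact le_abs_self c
      _ ≤ |c| * (‖toMinus S.A‖ * ‖h‖) := by gcongr; exact (toMinus S.A).le_opNorm h
      _ = _ := by ring
  let R₀ : H →L[ℂ] H := LinearMap.mkContinuous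
    { toFun := fun h => incl S.A (r h)
      map_add' := fun g h => by rw [hr_add, map_add]
      map_smul' := fun a h => by rw [hr_smul, map_smul, RingHom.id_apply] }
    (|c| * ‖toMinus S.A‖) hr_bound
  have hTpos : 0 < ‖R₀.comp S.F‖ + 1 := by positivity
  -- The summand `1` keeps the radius meaningful when `R₀ F = 0`.
  refine ⟨1 / (‖R₀.comp S.F‖ + 1), by positivity, fun z hz => ?_⟩
  have hlt : ‖(z - z₀) • R₀.comp S.F‖ < 1 := by
    rw [Metric.mem_ball, dist_eq_norm, lt_div_iff₀ hTpos] at hz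
    rw [norm_smul]
    exact lt_of_le_of_lt (mul_le_mul_of_nonneg_left (by linarith) (norm_nonneg _)) hz
  obtain ⟨U, hU⟩ := isUnit_one_sub_of_norm_lt_one hlt
  have hUx : ∀ x, (U : H →L[ℂ] H) x = x - (z - z₀) • incl S.A (r (S.F x)) := fun x => by
    rw [hU]
    rfl
  -- The pencil at `z` is the pencil at `z₀` after the correction `u ↦ u - (z - z₀) r (F u)`, and
  -- this correction acts in `H` as the invertible operator `U`.
  have back : ∀ u, pencil S.D S.F z₀ (u - (z - z₀) • r (S.F (incl S.A u))) =
      pencil S.D S.F z u := fun u => by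
    rw [map_sub, map_smul, hr, ← pencil_eq_pencil_sub]
  have incl_back : ∀ u, incl S.A (u - (z - z₀) • r (S.F (incl S.A u))) =
      (U : H →L[ℂ] H) (incl S.A u) := fun u => by
    rw [hUx, map_sub, map_smul]
  -- The equation is first solved in `H` by inverting `U`. The solution `x` lies in `H₊`, because it
  -- differs from `u₀` by a value of the resolvent.
  have solve : ∀ u₀, ∃ u, pencil S.D S.F z u = pencil S.D S.F z₀ u₀ := fun u₀ => by
    obtain ⟨x, hx⟩ : ∃ x, (U : H →L[ℂ] H) x = incl S.A u₀ := ⟨_, unit_apply_inv_apply U _⟩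
    have hi : incl S.A (u₀ + (z - z₀) • r (S.F x)) = x := by
      rw [map_add, map_smul, ← hx, hUx]
      abel
    refine ⟨u₀ + (z - z₀) • r (S.F x), ?_⟩
    rw [pencil_eq_pencil_sub _ _ z z₀, hi, map_add, map_smul, hr, add_sub_cancel_right]
  refine ⟨?_, fun h => ?_, fun e => ?_, ‖(↑U⁻¹ : H →L[ℂ] H)‖ * c, fun u h e hu => ?_⟩
  · rw [injective_iff_map_eq_zero]
    intro u hu
    have h1 : u - (z - z₀) • r (S.F (incl S.A u)) = 0 := hinj (by rw [back, hu, map_zero])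
    have h2 := incl_back u
    rw [h1, map_zero] at h2
    apply incl_injective
    rw [← unit_inv_apply_apply U (incl S.A u), ← h2, map_zero, map_zero]
  · obtain ⟨u, hu⟩ := solve (r h)
    exact ⟨u, hu.trans (hr h)⟩
  · obtain ⟨u₀, hu₀⟩ := hK e
    obtain ⟨u, hu⟩ := solve u₀
    exact ⟨u, hu.trans hu₀⟩
  · have h1 := hc _ h e ((back u).trans hu)
    rw [incl_back] at h1
    calc ‖incl S.A u‖ = ‖(↑U⁻¹ : H →L[ℂ] H) ((U : H →L[ℂ] H) (incl S.A u))‖ := by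
          rw [unit_inv_apply_apply]
      _ ≤ ‖(↑U⁻¹ : H →L[ℂ] H)‖ * ‖(U : H →L[ℂ] H) (incl S.A u)‖ :=
        ContinuousLinearMap.le_opNorm _ _
      _ ≤ ‖(↑U⁻¹ : H →L[ℂ] H)‖ * (c * ‖toMinus S.A h + S.K e‖) := by gcongr
      _ = _ := by ring

lemma isFormalAdjoint_of_isSelfAdjoint {S : H →ₗ.[ℂ] H} (hS : IsSelfAdjoint S) :
    S.IsFormalAdjoint S := by
  have := LinearPMap.adjoint_isFormalAdjoint hS.dense_domain
  rwa [LinearPMap.isSelfAdjoint_def.1 hS] at this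

/-- `|Im z| ‖x‖ ≤ ‖(S - z) x‖` for a symmetric operator `S`. -/
lemma abs_im_mul_norm_le {S : H →ₗ.[ℂ] H} (hS : S.IsFormalAdjoint S) (z : ℂ) (x : S.domain) :
    |z.im| * ‖(x : H)‖ ≤ ‖S x - z • (x : H)‖ := by
  have h1 : (⟪(x : H), S x⟫_ℂ).im = 0 := by
    have h : conj ⟪(x : H), S x⟫_ℂ = ⟪(x : H), S x⟫_ℂ := by
      rw [inner_conj_symm]
      exact hS x x
    exact Complex.conj_eq_iff_im.1 h
  have h2 : (⟪(x : H), S x - z • (x : H)⟫_ℂ).im = -(z.im * ‖(x : H)‖ ^ 2) := by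
    rw [inner_sub_right, inner_smul_right, Complex.sub_im, h1, inner_self_eq_norm_sq_to_K]
    simp [← Complex.ofReal_pow]
  have h3 : |z.im| * ‖(x : H)‖ * ‖(x : H)‖ ≤ ‖S x - z • (x : H)‖ * ‖(x : H)‖ := by
    calc |z.im| * ‖(x : H)‖ * ‖(x : H)‖ = |(⟪(x : H), S x - z • (x : H)⟫_ℂ).im| := by
          rw [h2, abs_neg, abs_mul, abs_of_nonneg (sq_nonneg ‖(x : H)‖)]
          ring
      _ ≤ ‖⟪(x : H), S x - z • (x : H)⟫_ℂ‖ := Complex.abs_im_le_norm _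
      _ ≤ ‖(x : H)‖ * ‖S x - z • (x : H)‖ := norm_inner_le_norm _ _
      _ = _ := mul_comm _ _
  rcases (norm_nonneg (x : H)).eq_or_lt with h0 | h0
  · rw [← h0]
    simp
  · exact le_of_mul_le_mul_right h3 h0

/-- Nonreal numbers are in the resolvent set of a self-adjoint operator. -/
lemma exists_sub_smul_eq {S : H →ₗ.[ℂ] H} (hS : IsSelfAdjoint S) {z : ℂ} (hz : z.im ≠ 0) (h : H) :
    ∃ x : S.domain, S x - z • (x : H) = h := by
  have hsym := isFormalAdjoint_of_isSelfAdjoint hS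
  have hz' : 0 < |z.im| := abs_pos.2 hz
  let f : S.graph →L[ℂ] H :=
    (ContinuousLinearMap.snd ℂ H H - z • ContinuousLinearMap.fst ℂ H H).comp S.graph.subtypeL
  have hf : ∀ x : S.domain, f ⟨_, S.mem_graph x⟩ = S x - z • (x : H) := fun _ => rfl
  have hex : ∀ p : S.graph, ∃ x : S.domain, p = ⟨_, S.mem_graph x⟩ := fun p => by
    obtain ⟨x, hx, hx'⟩ := (LinearPMap.mem_graph_iff _).1 p.2
    exact ⟨x, Subtype.ext (Prod.ext hx.symm hx'.symm)⟩
  have hcomplete : CompleteSpace S.graph :=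
    (show IsClosed (S.graph : Set (H × H)) from hS.isClosed).completeSpace_coe
  -- With `n = ‖(S - z) x‖`, the bounds `‖x‖ ≤ n / |Im z|` and `‖S x‖ ≤ n + ‖z‖ n / |Im z|` are
  -- added, which dominates the maximum that is the graph norm. This makes the range of `S - z`
  -- closed.
  have hanti : AntilipschitzWith (1 + (1 + ‖z‖₊) * ‖z.im‖₊⁻¹) f := by
    refine f.antilipschitz_of_bound fun p => ?_
    obtain ⟨x, rfl⟩ := hex p
    rw [hf]
    set n := ‖S x - z • (x : H)‖ with hn
    have h1 : ‖(x : H)‖ ≤ |z.im|⁻¹ * n := by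
      rw [← div_eq_inv_mul, le_div_iff₀ hz', mul_comm]
      exact abs_im_mul_norm_le hsym z x
    have h2 : ‖S x‖ ≤ n + ‖z‖ * (|z.im|⁻¹ * n) := by
      calc ‖S x‖ = ‖(S x - z • (x : H)) + z • (x : H)‖ := by rw [sub_add_cancel]
        _ ≤ n + ‖z • (x : H)‖ := norm_add_le _ _
        _ ≤ n + ‖z‖ * (|z.im|⁻¹ * n) := by rw [norm_smul]; gcongr
    have hn0 : 0 ≤ n := norm_nonneg _
    have h3 : 0 ≤ |z.im|⁻¹ * n := by positivity
    have h4 : 0 ≤ ‖z‖ * (|z.im|⁻¹ * n) := by positivity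
    have h5 : ‖(⟨_, S.mem_graph x⟩ : S.graph)‖ = max ‖(x : H)‖ ‖S x‖ := rfl
    rw [h5]
    push_cast
    rw [Real.norm_eq_abs]
    refine max_le ?_ ?_ <;> linarith
  have hcl : IsClosed (LinearMap.range f.toLinearMap : Set H) :=
    hanti.isClosed_range f.uniformContinuous
  have : CompleteSpace (LinearMap.range f.toLinearMap) := hcl.completeSpace_coe
  -- A vector orthogonal to the range satisfies `S* y = conj z • y`. As `S* = S`, it would be an
  -- eigenvector of `S` with nonreal eigenvalue, so it is zero.
  have hbot : (LinearMap.range f.toLinearMap)ᗮ = ⊥ := by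
    rw [Submodule.eq_bot_iff]
    intro y hy
    have hy' : ∀ x : S.domain, ⟪conj z • y, (x : H)⟫_ℂ = ⟪y, S x⟫_ℂ := fun x => by
      have := (Submodule.mem_orthogonal' _ _).1 hy _ ⟨⟨_, S.mem_graph x⟩, hf x⟩
      rw [inner_sub_right, inner_smul_right, sub_eq_zero] at this
      rw [inner_smul_left, Complex.conj_conj, this]
    have hmem := LinearPMap.mem_adjoint_domain_of_exists (T := S) y ⟨_, hy'⟩
    have happ := LinearPMap.adjoint_apply_eq hS.dense_domain ⟨y, hmem⟩ hy'
    have hgr : (y, conj z • y) ∈ S.graph := by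
      rw [← LinearPMap.isSelfAdjoint_def.1 hS]
      exact (LinearPMap.mem_graph_iff _).2 ⟨⟨y, hmem⟩, rfl, happ⟩
    obtain ⟨x, hx, hx'⟩ := (LinearPMap.mem_graph_iff _).1 hgr
    have hb := abs_im_mul_norm_le hsym (conj z) x
    simp only at hx hx'
    rw [hx', hx, sub_self, norm_zero, Complex.conj_im, abs_neg] at hb
    have : ‖y‖ ≤ 0 := by
      by_contra! hlt
      exact absurd hb (not_le.2 (mul_pos hz' hlt))
    exact norm_le_zero_iff.1 this
  have htop := Submodule.orthogonal_eq_bot_iff.1 hbot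
  obtain ⟨p, hp⟩ := (htop ▸ Submodule.mem_top : h ∈ LinearMap.range f.toLinearMap)
  obtain ⟨x, rfl⟩ := hex p
  exact ⟨x, hp⟩

/-- Symmetry of `S ⊇ A` makes `A* u` the orthogonal projection of `S u` onto `H₀`. Hence the graph
norm of `S` controls the norm of `H₊`. -/
lemma norm_starPlus_le {A S : H →ₗ.[ℂ] H} (hAS : A ≤ S) (hS : S.IsFormalAdjoint S)
    (u : HPlus A) (x : S.domain) (hu : incl A u = x) : ‖starPlus A u‖ ≤ ‖S x‖ := by
  have h1 : ∀ w ∈ DomClosure A, ⟪((starPlus A u : DomClosure A) : H), w⟫_ℂ = ⟪S x, w⟫_ℂ := by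
    intro w hw
    have hcl : IsClosed {w : H | ⟪((starPlus A u : DomClosure A) : H), w⟫_ℂ = ⟪S x, w⟫_ℂ} :=
      isClosed_eq (by fun_prop) (by fun_prop)
    refine closure_minimal (fun y hy => ?_) hcl hw
    have h2 : A ⟨y, hy⟩ = S ⟨y, hAS.1 hy⟩ := hAS.2 rfl
    have h3 := starPlus_inner A u ⟨y, hy⟩
    rw [h2, hu] at h3
    exact h3.trans (hS x ⟨y, hAS.1 hy⟩).symm
  have h2 := h1 _ (starPlus A u).2
  rw [inner_self_eq_norm_sq_to_K] at h2
  have h3 : ‖starPlus A u‖ * ‖starPlus A u‖ ≤ ‖S x‖ * ‖starPlus A u‖ := by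
    calc ‖starPlus A u‖ * ‖starPlus A u‖ =
        ‖((‖((starPlus A u : DomClosure A) : H)‖ : ℂ)) ^ 2‖ := by
          simp [pow_two]
      _ = ‖⟪S x, ((starPlus A u : DomClosure A) : H)⟫_ℂ‖ := congrArg _ h2
      _ ≤ _ := norm_inner_le_norm _ _
  rcases (norm_nonneg (starPlus A u)).eq_or_lt with h0 | h0
  · rw [← h0]
    exact norm_nonneg _
  · exact le_of_mul_le_mul_right h3 h0

lemma norm_plus_le (A : H →ₗ.[ℂ] H) (u : HPlus A) : ‖u‖ ≤ ‖incl A u‖ + ‖starPlus A u‖ := by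
  have h : ‖u‖ ^ 2 = ‖incl A u‖ ^ 2 + ‖starPlus A u‖ ^ 2 := by
    have := plus_inner_eq A u u
    simp only [inner_self_eq_norm_sq_to_K] at this
    exact_mod_cast this
  refine abs_le_of_sq_le_sq' ?_ (by positivity) |>.2
  nlinarith [mul_nonneg (norm_nonneg (incl A u)) (norm_nonneg (starPlus A u))]

variable {A : H →ₗ.[ℂ] H} {D : HPlus A →L[ℂ] HMinus A}

/-- The solution is the resolvent of the self-adjoint operator `S` contained in `𝔻`. Its bound in
`H` improves to one in `H₊` because `‖A* v‖ ≤ ‖S v‖`. -/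
lemma IsSelfAdjointBiExtension.exists_pencil_eq (h : IsSelfAdjointBiExtension A D) {z : ℂ}
    (hz : z.im ≠ 0) : ∃ c : ℝ, 0 ≤ c ∧ ∀ g : H, ∃ v : HPlus A,
      pencil D (ContinuousLinearMap.id ℂ H) z v = toMinus A g ∧ ‖v‖ ≤ c * ‖g‖ := by
  obtain ⟨S, hS, hAS, hSa⟩ := h.hat_selfAdjoint
  have hsym := isFormalAdjoint_of_isSelfAdjoint hSa
  have hz' : 0 < |z.im| := abs_pos.2 hz
  refine ⟨|z.im|⁻¹ + (1 + ‖z‖ * |z.im|⁻¹), by positivity, fun g => ?_⟩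
  obtain ⟨x, hx⟩ := exists_sub_smul_eq hSa hz g
  have hg : ((x : H), S x) ∈ hatGraph D := hS ▸ S.mem_graph x
  obtain ⟨v, hv, hv'⟩ := hg
  simp only at hv hv'
  refine ⟨v, ?_, ?_⟩
  · rw [pencil_apply_eq_sub, ContinuousLinearMap.id_apply, hv, hv', ← map_smul, ← map_sub, hx]
  · have h1 : ‖(x : H)‖ ≤ |z.im|⁻¹ * ‖g‖ := by
      rw [← div_eq_inv_mul, le_div_iff₀ hz', mul_comm, ← hx]
      exact abs_im_mul_norm_le hsym z x
    have h2 : ‖S x‖ ≤ ‖g‖ + ‖z‖ * (|z.im|⁻¹ * ‖g‖) := by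
      calc ‖S x‖ = ‖g + z • (x : H)‖ := by rw [← hx, sub_add_cancel]
        _ ≤ ‖g‖ + ‖z • (x : H)‖ := norm_add_le _ _
        _ ≤ ‖g‖ + ‖z‖ * (|z.im|⁻¹ * ‖g‖) := by rw [norm_smul]; gcongr
    have h3 := norm_plus_le A v
    have h4 := norm_starPlus_le hAS hsym v x hv
    rw [hv] at h3
    linarith

/-- `(𝔻 - z)⁻¹` is continuous from the norm of `H₋` to the norm of `H`, for nonreal `z`: it is the
adjoint of the bounded operator `(𝔻 - conj z)⁻¹` from `H` to `H₊`. -/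
lemma IsSelfAdjointBiExtension.norm_incl_le (h : IsSelfAdjointBiExtension A D) {z : ℂ}
    (hz : z.im ≠ 0) : ∃ c : ℝ, 0 ≤ c ∧ ∀ u : HPlus A,
      ‖incl A u‖ ≤ c * ‖pencil D (ContinuousLinearMap.id ℂ H) z u‖ := by
  have hz' : (conj z).im ≠ 0 := by simpa using hz
  obtain ⟨c, hc, hex⟩ := h.exists_pencil_eq hz'
  refine ⟨c, hc, fun u => ?_⟩
  obtain ⟨v, hv, hvc⟩ := hex (incl A u)
  have hD : ∀ u v, D u v = conj (D v u) := fun u v => by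
    conv_lhs => rw [← h.selfAdjoint]
    rw [bAdjoint_apply]
  -- With `v` solving the pencil at `conj z` for the right side `u`, the identity `𝔻 = 𝔻*` moves the
  -- pencil from `v` to `u`.
  have h1 : ⟪incl A u, incl A u⟫_ℂ = conj (pencil D (ContinuousLinearMap.id ℂ H) z u v) := by
    rw [← toMinus_apply, ← hv, pencil_apply, pencil_apply, hD v u]
    simp [inner_conj_symm]
  have h2 : ‖incl A u‖ * ‖incl A u‖ ≤
      c * ‖pencil D (ContinuousLinearMap.id ℂ H) z u‖ * ‖incl A u‖ := by
    calc ‖incl A u‖ * ‖incl A u‖ = ‖⟪incl A u, incl A u⟫_ℂ‖ := by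
          rw [inner_self_eq_norm_sq_to_K]
          simp [pow_two]
      _ = ‖pencil D (ContinuousLinearMap.id ℂ H) z u v‖ := by rw [h1, RCLike.norm_conj]
      _ ≤ ‖pencil D (ContinuousLinearMap.id ℂ H) z u‖ * ‖v‖ := ContinuousLinearMap.le_opNorm _ _
      _ ≤ ‖pencil D (ContinuousLinearMap.id ℂ H) z u‖ * (c * ‖incl A u‖) := by gcongr
      _ = _ := by ring
  rcases (norm_nonneg (incl A u)).eq_or_lt with h0 | h0
  · rw [← h0]
    positivity
  · exact le_of_mul_le_mul_right h2 h0

end Resolvent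

/-! ### The block matrix on `E ⊕ E ⊕ E ⊕ E`, the projection `diag (0, I, 0, 0)`, and the inverse
pencil. -/

section Blocks

variable {E : Type*} [NormedAddCommGroup E] [InnerProductSpace ℂ E] [CompleteSpace E]

lemma block4_apply (D₁ D₂ : E →L[ℂ] E) (x : E4 E) :
    block4 D₁ D₂ x 0 = Complex.I • x 1 ∧ block4 D₁ D₂ x 1 = -(Complex.I • x 0) ∧
      block4 D₁ D₂ x 2 = D₁ (x 2) ∧ block4 D₁ D₂ x 3 = D₂ (x 3) := ⟨rfl, rfl, rfl, rfl⟩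

lemma proj4_apply (x : E4 E) :
    proj4 E x 0 = 0 ∧ proj4 E x 1 = x 1 ∧ proj4 E x 2 = 0 ∧ proj4 E x 3 = 0 :=
  ⟨rfl, rfl, rfl, rfl⟩

lemma block4_isSelfAdjoint {D₁ D₂ : E →L[ℂ] E} (h₁ : IsSelfAdjoint D₁) (h₂ : IsSelfAdjoint D₂) :
    IsSelfAdjoint (block4 D₁ D₂) := by
  rw [ContinuousLinearMap.isSelfAdjoint_iff_isSymmetric] at *
  intro x y
  obtain ⟨hx0, hx1, hx2, hx3⟩ := block4_apply D₁ D₂ x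
  obtain ⟨hy0, hy1, hy2, hy3⟩ := block4_apply D₁ D₂ y
  have e₁ := h₁ (x 2) (y 2)
  have e₂ := h₂ (x 3) (y 3)
  simp only [ContinuousLinearMap.coe_coe] at e₁ e₂ ⊢
  rw [PiLp.inner_apply, PiLp.inner_apply, Fin.sum_univ_four, Fin.sum_univ_four,
    hx0, hx1, hx2, hx3, hy0, hy1, hy2, hy3, e₁, e₂]
  simp only [inner_smul_left, inner_smul_right, inner_neg_left, inner_neg_right, Complex.conj_I]
  ring

lemma proj4_symmetric (x y : E4 E) : ⟪proj4 E x, y⟫_ℂ = ⟪x, proj4 E y⟫_ℂ := by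
  obtain ⟨hx0, hx1, hx2, hx3⟩ := proj4_apply x
  obtain ⟨hy0, hy1, hy2, hy3⟩ := proj4_apply y
  rw [PiLp.inner_apply, PiLp.inner_apply, Fin.sum_univ_four, Fin.sum_univ_four,
    hx0, hx1, hx2, hx3, hy0, hy1, hy2, hy3]
  simp

lemma proj4_proj4 (x : E4 E) : proj4 E (proj4 E x) = proj4 E x := by
  ext i
  fin_cases i <;> rfl

/-- `F = diag (0, I, 0, 0)` commutes with the square of the block matrix. -/
lemma inner_block4_proj4 (D₁ D₂ : E →L[ℂ] E) (x y : E4 E) :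
    ⟪block4 D₁ D₂ (proj4 E x), block4 D₁ D₂ y⟫_ℂ =
      ⟪block4 D₁ D₂ x, block4 D₁ D₂ (proj4 E y)⟫_ℂ := by
  obtain ⟨hx0, hx1, hx2, hx3⟩ := block4_apply D₁ D₂ x
  obtain ⟨hy0, hy1, hy2, hy3⟩ := block4_apply D₁ D₂ y
  obtain ⟨hX0, hX1, hX2, hX3⟩ := block4_apply D₁ D₂ (proj4 E x)
  obtain ⟨hY0, hY1, hY2, hY3⟩ := block4_apply D₁ D₂ (proj4 E y)
  obtain ⟨hpx0, hpx1, hpx2, hpx3⟩ := proj4_apply x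
  obtain ⟨hpy0, hpy1, hpy2, hpy3⟩ := proj4_apply y
  rw [PiLp.inner_apply, PiLp.inner_apply, Fin.sum_univ_four, Fin.sum_univ_four,
    hx0, hx1, hx2, hx3, hy0, hy1, hy2, hy3, hX0, hX1, hX2, hX3, hY0, hY1, hY2, hY3,
    hpx0, hpx1, hpx2, hpx3, hpy0, hpy1, hpy2, hpy3]
  simp

/-- The inverse of the block matrix minus `z diag (0, I, 0, 0)`. -/
def block4Inv (D₁ D₂ : (E →L[ℂ] E)ˣ) (z : ℂ) : E4 E →L[ℂ] E4 E :=
  into4 ![Complex.I • coord E 1 + z • coord E 0, -(Complex.I • coord E 0),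
    (↑D₁⁻¹ : E →L[ℂ] E).comp (coord E 2), (↑D₂⁻¹ : E →L[ℂ] E).comp (coord E 3)]

lemma block4Inv_apply (D₁ D₂ : (E →L[ℂ] E)ˣ) (z : ℂ) (x : E4 E) :
    block4Inv D₁ D₂ z x 0 = Complex.I • x 1 + z • x 0 ∧
      block4Inv D₁ D₂ z x 1 = -(Complex.I • x 0) ∧
      block4Inv D₁ D₂ z x 2 = (↑D₁⁻¹ : E →L[ℂ] E) (x 2) ∧
      block4Inv D₁ D₂ z x 3 = (↑D₂⁻¹ : E →L[ℂ] E) (x 3) := ⟨rfl, rfl, rfl, rfl⟩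

lemma block4_pencil_apply (D₁ D₂ : E →L[ℂ] E) (z : ℂ) (x : E4 E) :
    (block4 D₁ D₂ - z • proj4 E) x 0 = Complex.I • x 1 ∧
      (block4 D₁ D₂ - z • proj4 E) x 1 = -(Complex.I • x 0) - z • x 1 ∧
      (block4 D₁ D₂ - z • proj4 E) x 2 = D₁ (x 2) ∧
      (block4 D₁ D₂ - z • proj4 E) x 3 = D₂ (x 3) := by
  have h : ∀ i, (block4 D₁ D₂ - z • proj4 E) x i = block4 D₁ D₂ x i - z • proj4 E x i :=
    fun _ => rfl
  obtain ⟨h0, h1, h2, h3⟩ := block4_apply D₁ D₂ x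
  obtain ⟨p0, p1, p2, p3⟩ := proj4_apply x
  rw [h, h, h, h, h0, h1, h2, h3, p0, p1, p2, p3]
  simp

/-- In the upper block `((0, i), (-i, -z))` the entry opposite `-z` is zero, so the inverse is
polynomial in `z` and exists at every `z`. Its entry `z` is the source of the term `z L`. -/
lemma block4_pencil_block4Inv (D₁ D₂ : (E →L[ℂ] E)ˣ) (z : ℂ) (x : E4 E) :
    (block4 (D₁ : E →L[ℂ] E) D₂ - z • proj4 E) (block4Inv D₁ D₂ z x) = x := by
  obtain ⟨h0, h1, h2, h3⟩ := block4_pencil_apply (D₁ : E →L[ℂ] E) D₂ z (block4Inv D₁ D₂ z x)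
  obtain ⟨i0, i1, i2, i3⟩ := block4Inv_apply D₁ D₂ z x
  ext i
  fin_cases i
  · refine h0.trans ?_
    rw [i1, smul_neg, smul_smul, Complex.I_mul_I, neg_one_smul, neg_neg]
    rfl
  · refine h1.trans ?_
    rw [i0, i1, smul_add, smul_neg, smul_smul, smul_smul, smul_smul, Complex.I_mul_I,
      mul_comm z, neg_one_smul, neg_add, neg_neg, sub_neg_eq_add, neg_add_cancel_right]
    rfl
  · exact h2.trans (by rw [i2]; exact unit_apply_inv_apply _ _)
  · exact h3.trans (by rw [i3]; exact unit_apply_inv_apply _ _)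

lemma block4Inv_block4_pencil (D₁ D₂ : (E →L[ℂ] E)ˣ) (z : ℂ) (x : E4 E) :
    block4Inv D₁ D₂ z ((block4 (D₁ : E →L[ℂ] E) D₂ - z • proj4 E) x) = x := by
  obtain ⟨h0, h1, h2, h3⟩ := block4_pencil_apply (D₁ : E →L[ℂ] E) D₂ z x
  obtain ⟨i0, i1, i2, i3⟩ := block4Inv_apply D₁ D₂ z
    ((block4 (D₁ : E →L[ℂ] E) D₂ - z • proj4 E) x)
  ext i
  fin_cases i
  · refine i0.trans ?_
    rw [h0, h1, smul_sub, smul_neg, smul_smul, smul_smul, smul_smul, Complex.I_mul_I,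
      mul_comm z, neg_one_smul, neg_neg, sub_add_cancel]
    rfl
  · refine i1.trans ?_
    rw [h0, smul_smul, Complex.I_mul_I, neg_one_smul, neg_neg]
    rfl
  · exact i2.trans (by rw [h2]; exact unit_inv_apply_apply _ _)
  · exact i3.trans (by rw [h3]; exact unit_inv_apply_apply _ _)

end Blocks

/-! ### The identities `P K̂ = L^(1/2)` and `K̂* P K̂ = L`. -/

section RangeProj

variable {E : Type*} [NormedAddCommGroup E] [InnerProductSpace ℂ E] [CompleteSpace E]

lemma rangeProj_symmetric (L : E →L[ℂ] E) (x y : E) :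
    ⟪rangeProj L x, y⟫_ℂ = ⟪x, rangeProj L y⟫_ℂ :=
  Submodule.inner_starProjection_left_eq_right _ _ _

lemma rangeProj_rangeProj (L : E →L[ℂ] E) (x : E) :
    rangeProj L (rangeProj L x) = rangeProj L x :=
  Submodule.starProjection_eq_self_iff.2 (Submodule.starProjection_apply_mem _ _)

lemma sqrt_symmetric (L : E →L[ℂ] E) (x y : E) : ⟪CFC.sqrt L x, y⟫_ℂ = ⟪x, CFC.sqrt L y⟫_ℂ :=
  ContinuousLinearMap.isSelfAdjoint_iff_isSymmetric.1
    (IsSelfAdjoint.of_nonneg (CFC.sqrt_nonneg L)) x y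

variable {L : E →L[ℂ] E} (hL : 0 ≤ L)
include hL

lemma sqrt_sqrt_apply (x : E) : CFC.sqrt L (CFC.sqrt L x) = L x := by
  exact DFunLike.congr_fun (CFC.sqrt_mul_sqrt_self L hL) x

/-- `ker L ⊂ ker L^(1/2)`. -/
lemma sqrt_rangeProj (x : E) : CFC.sqrt L (rangeProj L x) = CFC.sqrt L x := by
  have hsym := ContinuousLinearMap.isSelfAdjoint_iff_isSymmetric.1 (IsSelfAdjoint.of_nonneg hL)
  have h1 : x - rangeProj L x ∈ (LinearMap.range L.toLinearMap).topologicalClosureᗮ :=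
    Submodule.sub_starProjection_mem_orthogonal x
  have h2 : L (x - rangeProj L x) = 0 := by
    refine ext_inner_right ℂ fun y => ?_
    rw [inner_zero_left]
    refine (hsym _ _).trans ((Submodule.mem_orthogonal' _ _).1 h1 _ ?_)
    exact subset_closure ⟨y, rfl⟩
  -- For `v` in `ker L`, `‖L^(1/2) v‖² = (v, L v) = 0`.
  have h3 : CFC.sqrt L (x - rangeProj L x) = 0 := by
    rw [← inner_self_eq_zero (𝕜 := ℂ), sqrt_symmetric, sqrt_sqrt_apply hL, h2, inner_zero_right]
  rw [map_sub, sub_eq_zero] at h3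
  exact h3.symm

/-- This is the adjoint of the identity `sqrt_rangeProj`, both factors being symmetric. -/
lemma rangeProj_sqrt (x : E) : rangeProj L (CFC.sqrt L x) = CFC.sqrt L x := by
  refine ext_inner_right ℂ fun y => ?_
  rw [rangeProj_symmetric, sqrt_symmetric, sqrt_rangeProj hL, sqrt_symmetric]

lemma rangeProj_hatK (x : E) : rangeProj L (hatK L x) = CFC.sqrt L x := by
  have h : hatK L x = x - rangeProj L x + CFC.sqrt L (rangeProj L x) := rfl
  rw [h, map_add, map_sub, rangeProj_rangeProj, sub_self, zero_add, rangeProj_sqrt hL,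
    sqrt_rangeProj hL]

lemma inner_hatK_rangeProj_hatK (x y : E) :
    ⟪hatK L y, rangeProj L (hatK L x)⟫_ℂ = ⟪y, L x⟫_ℂ := by
  rw [← rangeProj_rangeProj, ← rangeProj_symmetric, rangeProj_hatK hL, rangeProj_hatK hL,
    sqrt_symmetric, sqrt_sqrt_apply hL]

end RangeProj

/-! ### Self-adjoint parts contained in a summand. -/

section SelfAdjointParts

variable {H : Type*} [NormedAddCommGroup H] [InnerProductSpace ℂ H] [CompleteSpace H]
variable {G : Type*} [NormedAddCommGroup G] [InnerProductSpace ℂ G] [CompleteSpace G]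
variable {H₂ : Type*} [NormedAddCommGroup H₂] [InnerProductSpace ℂ H₂] [CompleteSpace H₂]

/-- An operator is self-adjoint iff its graph coincides with its adjoint relation. -/
lemma isSelfAdjoint_iff_mem_graph (T : H →ₗ.[ℂ] H) :
    IsSelfAdjoint T ↔
      ∀ y w : H, (y, w) ∈ T.graph ↔ ∀ x : T.domain, ⟪w, (x : H)⟫_ℂ = ⟪y, T x⟫_ℂ := by
  have key : Dense (T.domain : Set H) → ∀ y w : H, (y, w) ∈ T.adjoint.graph ↔
      ∀ x : T.domain, ⟪w, (x : H)⟫_ℂ = ⟪y, T x⟫_ℂ := fun hd y w => by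
    constructor
    · intro h x
      obtain ⟨y', rfl, rfl⟩ := (LinearPMap.mem_graph_iff _).1 h
      exact LinearPMap.adjoint_isFormalAdjoint hd y' x
    · intro h
      have hm := LinearPMap.mem_adjoint_domain_of_exists (T := T) y ⟨w, h⟩
      exact (LinearPMap.mem_graph_iff _).2
        ⟨⟨y, hm⟩, rfl, LinearPMap.adjoint_apply_eq hd ⟨y, hm⟩ h⟩
  constructor
  · intro h
    have := key h.dense_domain
    rwa [LinearPMap.isSelfAdjoint_def.1 h] at this
  · intro h
    have hd : Dense (T.domain : Set H) := by
      rw [Submodule.dense_iff_topologicalClosure_eq_top,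
        Submodule.topologicalClosure_eq_top_iff, Submodule.eq_bot_iff]
      intro w hw
      -- A vector `w` orthogonal to the domain gives the pair `(0, w)` of the adjoint relation; that
      -- pair lies in the graph of an operator, which forces `w = 0`.
      have h0 : ((0 : H), w) ∈ T.graph := (h 0 w).2 fun x => by
        rw [inner_zero_left]
        exact (Submodule.mem_orthogonal' _ _).1 hw _ x.2
      exact LinearPMap.graph_fst_eq_zero_snd _ h0 rfl
    rw [LinearPMap.isSelfAdjoint_def]
    refine LinearPMap.eq_of_eq_graph ?_
    ext p
    exact (key hd p.1 p.2).trans (h p.1 p.2).symm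

/-- The graph criterion involves only the graph and inner products, so it is invariant under a
unitary map carrying one graph onto the other. -/
lemma IsSelfAdjoint.of_graph_iff {X Y : Type*} [NormedAddCommGroup X] [InnerProductSpace ℂ X]
    [CompleteSpace X] [NormedAddCommGroup Y] [InnerProductSpace ℂ Y] [CompleteSpace Y]
    {T : X →ₗ.[ℂ] X} {T' : Y →ₗ.[ℂ] Y} (J : X ≃ₗᵢ[ℂ] Y)
    (hJ : ∀ x y, (x, y) ∈ T.graph ↔ (J x, J y) ∈ T'.graph) (hT : IsSelfAdjoint T) :
    IsSelfAdjoint T' := by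
  rw [isSelfAdjoint_iff_mem_graph] at hT ⊢
  intro y w
  obtain ⟨y, rfl⟩ := J.surjective y
  obtain ⟨w, rfl⟩ := J.surjective w
  rw [← hJ, hT]
  constructor
  · intro h x
    obtain ⟨x₀, hx₀⟩ := J.surjective (x : Y)
    obtain ⟨t, ht⟩ := J.surjective (T' x)
    have hg : (x₀, t) ∈ T.graph := by
      rw [hJ, hx₀, ht]
      exact T'.mem_graph x
    obtain ⟨x', hx', hx''⟩ := (LinearPMap.mem_graph_iff _).1 hg
    have := h x'
    simp only at hx' hx''
    rwa [hx', hx'', ← J.inner_map_map, ← J.inner_map_map, hx₀, ht] at this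
  · intro h x
    obtain ⟨x', hx', hx''⟩ := (LinearPMap.mem_graph_iff _).1 ((hJ _ _).1 (T.mem_graph x))
    have := h x'
    simp only at hx' hx''
    rwa [hx', hx'', J.inner_map_map, J.inner_map_map] at this

lemma mem_inducedOn_graph (A : H →ₗ.[ℂ] H) (M : Submodule ℂ H) (x y : M) :
    (x, y) ∈ (inducedOn A M).graph ↔ ((x : H), (y : H)) ∈ A.graph := by
  simp only [LinearPMap.mem_graph_iff]
  constructor
  · rintro ⟨x', rfl, rfl⟩
    exact ⟨⟨_, x'.2.1⟩, rfl, rfl⟩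
  · rintro ⟨x', hx, hy⟩
    have hd : (x : H) ∈ A.domain := hx ▸ x'.2
    obtain rfl : x' = ⟨_, hd⟩ := Subtype.ext hx
    have hm : A ⟨(x : H), hd⟩ ∈ M := by
      rw [hy]
      exact y.2
    exact ⟨⟨x, hd, hm⟩, rfl, Subtype.ext hy⟩

lemma IsSelfAdjointPart.dense_domain {A : H →ₗ.[ℂ] H} {M : Submodule ℂ H}
    (h : IsSelfAdjointPart A M) : Dense ((inducedOn A M).domain : Set M) := by
  obtain ⟨_, -, -, h⟩ := h
  exact h.dense_domain

lemma IsSelfAdjointPart.isClosed {A : H →ₗ.[ℂ] H} {M : Submodule ℂ H}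
    (h : IsSelfAdjointPart A M) : IsClosed (M : Set H) := by
  obtain ⟨hc, -⟩ := h
  exact (completeSpace_coe_iff_isComplete.1 hc).isClosed

variable (G) in
/-- The subspace `0 ⊕ M₂` of `G ⊕ H₂`. -/
def zeroSum (M₂ : Submodule ℂ H₂) : Submodule ℂ (WithLp 2 (G × H₂)) where
  carrier := {x | x.fst = 0 ∧ x.snd ∈ M₂}
  zero_mem' := ⟨rfl, M₂.zero_mem⟩
  add_mem' := by
    rintro x y ⟨hx, hx'⟩ ⟨hy, hy'⟩
    exact ⟨by rw [WithLp.add_fst, hx, hy, add_zero], M₂.add_mem hx' hy'⟩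
  smul_mem' := by
    rintro r x ⟨hx, hx'⟩
    exact ⟨by rw [WithLp.smul_fst, hx, smul_zero], M₂.smul_mem r hx'⟩

lemma mem_zeroSum {M₂ : Submodule ℂ H₂} {x : WithLp 2 (G × H₂)} :
    x ∈ zeroSum G M₂ ↔ x.fst = 0 ∧ x.snd ∈ M₂ := Iff.rfl

lemma mem_zeroSum_orthogonal {M₂ : Submodule ℂ H₂} {x : WithLp 2 (G × H₂)} :
    x ∈ (zeroSum G M₂)ᗮ ↔ x.snd ∈ M₂ᗮ := by
  rw [Submodule.mem_orthogonal, Submodule.mem_orthogonal]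
  constructor
  · intro h m hm
    have := h (WithLp.toLp 2 ((0 : G), m)) ⟨rfl, hm⟩
    simpa [WithLp.prod_inner_apply] using this
  · rintro h y ⟨hy, hy'⟩
    rw [WithLp.prod_inner_apply]
    have h1 : ⟪y.fst, x.fst⟫_ℂ = 0 := by rw [hy, inner_zero_left]
    exact (congrArg₂ (· + ·) h1 (h _ hy')).trans (add_zero 0)

variable (G) in
/-- The unitary identification of `M₂` with `0 ⊕ M₂`. -/
def zeroSumEquiv (M₂ : Submodule ℂ H₂) : M₂ ≃ₗᵢ[ℂ] zeroSum G M₂ where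
  toFun m := ⟨WithLp.toLp 2 ((0 : G), (m : H₂)), rfl, m.2⟩
  invFun x := ⟨(x : WithLp 2 (G × H₂)).snd, x.2.2⟩
  left_inv _ := rfl
  right_inv x := Subtype.ext ((WithLp.equiv 2 (G × H₂)).injective (Prod.ext x.2.1.symm rfl))
  map_add' x y := Subtype.ext ((WithLp.equiv 2 (G × H₂)).injective
    (Prod.ext (add_zero (0 : G)).symm rfl))
  map_smul' r x := Subtype.ext ((WithLp.equiv 2 (G × H₂)).injective
    (Prod.ext (smul_zero r : r • (0 : G) = 0).symm rfl))
  norm_map' x := by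
    change ‖(WithLp.toLp 2 ((0 : G), (x : H₂)) : WithLp 2 (G × H₂))‖ = ‖(x : H₂)‖
    rw [WithLp.prod_norm_eq_of_L2]
    simp

/-- The complement of `0 ⊕ M₂` is `G ⊕ M₂ᗮ`, so the `G`-component of a vector always goes to the
complementary part and imposes no condition. -/
lemma reduces_zeroSum (B : G →L[ℂ] G) (A₂ : H₂ →ₗ.[ℂ] H₂) (M₂ : Submodule ℂ H₂) :
    Reduces (sumOp B A₂) (zeroSum G M₂) ↔ Reduces A₂ M₂ := by
  constructor
  · intro h x
    have hx : (WithLp.toLp 2 ((0 : G), (x : H₂)) : WithLp 2 (G × H₂)) ∈ (sumOp B A₂).domain := x.2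
    obtain ⟨y, z, hyz, hy, hAy, hz, hAz⟩ := h ⟨_, hx⟩
    refine ⟨⟨_, y.2⟩, ⟨_, z.2⟩, ?_, hy.2, hAy.2, mem_zeroSum_orthogonal.1 hz,
      mem_zeroSum_orthogonal.1 hAz⟩
    exact Subtype.ext (congrArg (fun w : (sumOp B A₂).domain => (w : WithLp 2 (G × H₂)).snd) hyz)
  · intro h x
    obtain ⟨y, z, hyz, hy, hAy, hz, hAz⟩ := h ⟨_, x.2⟩
    have hy' : (WithLp.toLp 2 ((0 : G), (y : H₂)) : WithLp 2 (G × H₂)) ∈ (sumOp B A₂).domain := y.2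
    have hz' : (WithLp.toLp 2 ((x : WithLp 2 (G × H₂)).fst, (z : H₂)) : WithLp 2 (G × H₂)) ∈
      (sumOp B A₂).domain := z.2
    refine ⟨⟨_, hy'⟩, ⟨_, hz'⟩, Subtype.ext ((WithLp.equiv 2 (G × H₂)).injective
      (Prod.ext (zero_add _).symm (congrArg Subtype.val hyz))), ⟨rfl, hy⟩, ⟨map_zero B, hAy⟩,
      mem_zeroSum_orthogonal.2 hz, mem_zeroSum_orthogonal.2 hAz⟩

lemma isSelfAdjointPart_zeroSum (B : G →L[ℂ] G) (A₂ : H₂ →ₗ.[ℂ] H₂) (M₂ : Submodule ℂ H₂) :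
    IsSelfAdjointPart (sumOp B A₂) (zeroSum G M₂) ↔ IsSelfAdjointPart A₂ M₂ := by
  let J := zeroSumEquiv G M₂
  have hc : CompleteSpace M₂ ↔ CompleteSpace (zeroSum G M₂) :=
    J.toIsometryEquiv.completeSpace_iff
  have hgr : ∀ x y, (x, y) ∈ (inducedOn A₂ M₂).graph ↔
      (J x, J y) ∈ (inducedOn (sumOp B A₂) (zeroSum G M₂)).graph := fun x y => by
    rw [mem_inducedOn_graph, mem_inducedOn_graph, mem_sumOp_graph]
    exact ⟨fun h => ⟨(map_zero B).symm, h⟩, fun h => h.2⟩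
  have hbot : zeroSum G M₂ ≠ ⊥ ↔ M₂ ≠ ⊥ := by
    rw [Submodule.ne_bot_iff, Submodule.ne_bot_iff]
    constructor
    · rintro ⟨x, hx, hx0⟩
      refine ⟨x.snd, hx.2, fun h => hx0 ?_⟩
      exact (WithLp.equiv 2 (G × H₂)).injective (Prod.ext hx.1 h)
    · rintro ⟨x, hx, hx0⟩
      exact ⟨WithLp.toLp 2 (0, x), ⟨rfl, hx⟩, fun h => hx0 (congrArg WithLp.snd h)⟩
  constructor
  · rintro ⟨h1, h2, h3, h4⟩
    have := hc.2 h1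
    refine ⟨this, hbot.1 h2, (reduces_zeroSum B A₂ M₂).1 h3,
      IsSelfAdjoint.of_graph_iff J.symm (fun x y => ?_) h4⟩
    rw [hgr, J.apply_symm_apply, J.apply_symm_apply]
  · rintro ⟨h1, h2, h3, h4⟩
    have := hc.1 h1
    exact ⟨this, hbot.2 h2, (reduces_zeroSum B A₂ M₂).2 h3, IsSelfAdjoint.of_graph_iff J hgr h4⟩

end SelfAdjointParts

/-! ### The projection `F₊` in `H₊`, and self-adjoint parts inside its range. -/

section System

variable {E : Type*} [NormedAddCommGroup E] [InnerProductSpace ℂ E] [CompleteSpace E]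
variable {H₂ : Type*} [NormedAddCommGroup H₂] [InnerProductSpace ℂ H₂] [CompleteSpace H₂]

lemma sumF_toLp {G : Type*} [NormedAddCommGroup G] [InnerProductSpace ℂ G] (F : G →L[ℂ] G)
    (x : WithLp 2 (G × H₂)) : sumF H₂ F x = WithLp.toLp 2 (F x.fst, x.snd) := rfl

lemma sumF_isSymmetricProjection {G : Type*} [NormedAddCommGroup G] [InnerProductSpace ℂ G]
    {F : G →L[ℂ] G} (hF : F.toLinearMap.IsSymmetricProjection) :
    (sumF H₂ F).toLinearMap.IsSymmetricProjection where
  isIdempotentElem := by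
    refine LinearMap.ext fun x => (WithLp.equiv 2 (G × H₂)).injective (Prod.ext ?_ rfl)
    exact LinearMap.congr_fun hF.isIdempotentElem x.fst
  isSymmetric := fun x y => by
    simp only [ContinuousLinearMap.coe_coe, sumF_toLp, WithLp.prod_inner_apply]
    exact congrArg (· + _) (hF.isSymmetric x.fst y.fst)

lemma proj4_isSymmetricProjection : (proj4 E).toLinearMap.IsSymmetricProjection where
  isIdempotentElem := LinearMap.ext proj4_proj4
  isSymmetric := proj4_symmetric

variable {D₁ D₂ : E →L[ℂ] E} {A₂ : H₂ →ₗ.[ℂ] H₂}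

/-- `F₊` is an orthogonal projection in `H₊`. -/
lemma exists_plus_projection (hB : IsSelfAdjoint (block4 D₁ D₂)) (A₂ : H₂ →ₗ.[ℂ] H₂) :
    ∃ F' : HPlus (sumOp (block4 D₁ D₂) A₂) →ₗ[ℂ] HPlus (sumOp (block4 D₁ D₂) A₂),
      F'.IsSymmetricProjection ∧
        ∀ u, incl _ (F' u) = sumF H₂ (proj4 E) (incl (sumOp (block4 D₁ D₂) A₂) u) := by
  let F' : HPlus (sumOp (block4 D₁ D₂) A₂) →L[ℂ] HPlus (sumOp (block4 D₁ D₂) A₂) :=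
    (mkPlus hB A₂).comp (((proj4 E).comp (fstPlus _ A₂)).prod (sndPlus _ A₂))
  have hF' : ∀ u, F' u = mkPlus hB A₂ (proj4 E (fstPlus _ A₂ u), sndPlus _ A₂ u) := fun _ => rfl
  refine ⟨F'.toLinearMap, ⟨LinearMap.ext fun u => ?_, fun u v => ?_⟩, fun _ => rfl⟩
  · change F' (F' u) = F' u
    rw [hF' (F' u), hF' u, fstPlus_mkPlus, sndPlus_mkPlus, proj4_proj4]
  · change ⟪F' u, v⟫_ℂ = ⟪u, F' v⟫_ℂ
    conv_lhs => rw [← mkPlus_fst_snd hB v]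
    conv_rhs => rw [← mkPlus_fst_snd hB u]
    rw [hF', hF', mkPlus_inner, mkPlus_inner, inner_block4_proj4, proj4_symmetric]

/-- A part of `A` in the range of `F₊` is contained in `H₂`, as the entry `-i I` of the block matrix
moves the second component out of that range. -/
lemma eq_zeroSum_of_le_range {M : Submodule ℂ (WithLp 2 (E4 E × H₂))}
    (hMF : ∀ x ∈ M, sumF H₂ (proj4 E) x = x)
    (hM : IsSelfAdjointPart (sumOp (block4 D₁ D₂) A₂) M) :
    M = zeroSum (E4 E) (M.map (WithLp.sndL 2 ℂ (E4 E) H₂).toLinearMap) := by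
  have hP : ∀ x ∈ M, proj4 E x.fst = x.fst := fun x hx => congrArg WithLp.fst (hMF x hx)
  have h0 : ∀ x ∈ M, x.fst = 0 := by
    have hcl : IsClosed {x : M | (x : WithLp 2 (E4 E × H₂)).fst = 0} :=
      isClosed_eq ((WithLp.fstL 2 ℂ (E4 E) H₂).continuous.comp continuous_subtype_val)
        continuous_const
    have hsub : ((inducedOn (sumOp (block4 D₁ D₂) A₂) M).domain : Set M) ⊆
        {x : M | (x : WithLp 2 (E4 E × H₂)).fst = 0} := by
      rintro x ⟨hx, hAx⟩
      have h1 := hP _ x.2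
      have h2 := hP _ hAx
      rw [sumOp_apply] at h2
      set g := (x : WithLp 2 (E4 E × H₂)).fst with hg
      have e1 : g 1 = 0 := by
        -- `A x` lies in `M`, so its component `0` vanishes; by the form of the block matrix that
        -- component is `i` times component `1` of `x`.
        have h3 : (0 : E) = Complex.I • g 1 := congrArg (fun w : E4 E => w 0) h2
        exact (smul_eq_zero.1 h3.symm).resolve_left Complex.I_ne_zero
      change g = 0
      rw [← h1]
      ext i
      fin_cases i
      · rfl
      · exact e1
      · rfl
      · rfl
    intro x hx
    exact closure_minimal hsub hcl (hM.dense_domain ⟨x, hx⟩)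
  ext x
  rw [mem_zeroSum]
  constructor
  · exact fun hx => ⟨h0 x hx, x, hx, rfl⟩
  · rintro ⟨hx, y, hy, hyx⟩
    have : x = y := (WithLp.equiv 2 (E4 E × H₂)).injective
      (Prod.ext (hx.trans (h0 y hy).symm) hyx.symm)
    rwa [this]

variable {V : ℂ → E →L[ℂ] E} {R : NevanlinnaRepresentation V}

/-! ### The constructed system: resolvent set, realization and minimality. -/

namespace Construction

/-- `D₁⁽¹⁾` as an invertible operator. -/
def D₁Unit (c : Construction R H₂) : (E →L[ℂ] E)ˣ := c.K₁₁ * c.Q₁⁻¹ * star c.K₁₁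

/-- `D₁⁽²⁾` as an invertible operator. -/
def D₂Unit (c : Construction R H₂) : (E →L[ℂ] E)ˣ := c.K₁₂ * c.Q₂⁻¹ * star c.K₁₂

lemma coe_D₁Unit (c : Construction R H₂) : (c.D₁Unit : E →L[ℂ] E) = c.D₁ := rfl

lemma coe_D₂Unit (c : Construction R H₂) : (c.D₂Unit : E →L[ℂ] E) = c.D₂ := rfl

lemma isSelfAdjoint_conjugate_inv {K Q : (E →L[ℂ] E)ˣ} (hQ : IsSelfAdjoint (Q : E →L[ℂ] E)) :
    IsSelfAdjoint ((K : E →L[ℂ] E) * (↑Q⁻¹ : E →L[ℂ] E) * star (K : E →L[ℂ] E)) := by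
  have hQ' : IsSelfAdjoint Q := Units.ext hQ
  have h : IsSelfAdjoint (↑Q⁻¹ : E →L[ℂ] E) := congrArg Units.val hQ'.inv
  exact h.conjugate _

/-- `K* (K Q⁻¹ K*)⁻¹ K = Q`. -/
lemma inner_conjugate_inv (K Q : (E →L[ℂ] E)ˣ) (e e' : E) :
    ⟪(↑(K * Q⁻¹ * star K)⁻¹ : E →L[ℂ] E) ((K : E →L[ℂ] E) e), (K : E →L[ℂ] E) e'⟫_ℂ =
      ⟪(Q : E →L[ℂ] E) e, e'⟫_ℂ := by
  have h : star K * (K * Q⁻¹ * star K)⁻¹ * K = Q := by group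
  have h' := DFunLike.congr_fun (congrArg Units.val h) e
  rw [← ContinuousLinearMap.adjoint_inner_left, ← h']
  rfl

lemma isSelfAdjoint_block4 (c : Construction R H₂) : IsSelfAdjoint (block4 c.D₁ c.D₂) :=
  block4_isSelfAdjoint (isSelfAdjoint_conjugate_inv c.Q₁_selfAdjoint)
    (isSelfAdjoint_conjugate_inv c.Q₂_selfAdjoint)

/-- The column with entries `P K̂`, `K̂`, `K₁₁`, `K₁₂`. -/
def column (c : Construction R H₂) : E →L[ℂ] E4 E :=
  into4 ![(rangeProj R.L).comp (hatK R.L), hatK R.L, (c.K₁₁ : E →L[ℂ] E), (c.K₁₂ : E →L[ℂ] E)]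

lemma column_apply (c : Construction R H₂) (e : E) :
    c.column e 0 = rangeProj R.L (hatK R.L e) ∧ c.column e 1 = hatK R.L e ∧
      c.column e 2 = (c.K₁₁ : E →L[ℂ] E) e ∧ c.column e 3 = (c.K₁₂ : E →L[ℂ] E) e :=
  ⟨rfl, rfl, rfl, rfl⟩

/-- The impedance function of the finite-dimensional part is `z L + Q₁ + Q₂`. -/
lemma inner_block4Inv_column (c : Construction R H₂) (z : ℂ) (e e' : E) :
    ⟪block4Inv c.D₁Unit c.D₂Unit z (c.column e), c.column e'⟫_ℂ =
      ⟪z • R.L e + (R.Q - c.G) e, e'⟫_ℂ := by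
  obtain ⟨h0, h1, h2, h3⟩ := c.column_apply e
  obtain ⟨h0', h1', h2', h3'⟩ := c.column_apply e'
  obtain ⟨i0, i1, i2, i3⟩ := block4Inv_apply c.D₁Unit c.D₂Unit z (c.column e)
  have hL : ⟪e, R.L e'⟫_ℂ = ⟪R.L e, e'⟫_ℂ := ((ContinuousLinearMap.isSelfAdjoint_iff_isSymmetric.1
    (IsSelfAdjoint.of_nonneg R.L_nonneg)) e e').symm
  rw [PiLp.inner_apply, Fin.sum_univ_four, i0, i1, i2, i3, h0, h1, h2, h3, h0', h1', h2', h3',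
    D₁Unit, D₂Unit, inner_conjugate_inv, inner_conjugate_inv, ← c.Q_sum]
  simp only [inner_add_left, inner_smul_left, inner_neg_left, add_apply]
  -- Moving `P` across makes the two terms with factor `i` opposite, so they cancel; the term with
  -- factor `z` becomes `z L`.
  rw [rangeProj_symmetric, rangeProj_rangeProj, rangeProj_symmetric,
    inner_hatK_rangeProj_hatK R.L_nonneg, hL]
  ring

/-- The transfer value includes uniqueness of the solution; the right side `e = 0` gives a trivial
kernel. -/
lemma pencil_injective (c : Construction R H₂) {z : ℂ} (hz : z.im ≠ 0) :
    Function.Injective (pencil (bReal c.AA₂) (ContinuousLinearMap.id ℂ H₂) z) := by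
  rw [injective_iff_map_eq_zero]
  intro v hv
  obtain ⟨u, -, hu, -⟩ := c.transfer z hz 0
  rw [hu v (by rw [hv, map_zero]), hu 0 (by rw [map_zero, map_zero])]

lemma mem_rho (c : Construction R H₂) {z : ℂ} (hz : z.im ≠ 0) : z ∈ c.system.rho := by
  have hB := c.isSelfAdjoint_block4
  have hinv := block4Inv_block4_pencil c.D₁Unit c.D₂Unit z
  have hinv' := block4_pencil_block4Inv c.D₁Unit c.D₂Unit z
  rw [coe_D₁Unit, coe_D₂Unit] at hinv hinv'
  have solve : ∀ (a : E4 E) (u₂ : HPlus c.A₂), ∃ u,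
      pencil (sumD (block4 c.D₁ c.D₂) (bReal c.AA₂)) (sumF H₂ (proj4 E)) z u =
      sumMinus (block4 c.D₁ c.D₂) a
        (pencil (bReal c.AA₂) (ContinuousLinearMap.id ℂ H₂) z u₂) := fun a u₂ => by
    refine ⟨mkPlus hB c.A₂ (block4Inv c.D₁Unit c.D₂Unit z a, u₂), ?_⟩
    rw [pencil_sum, fstPlus_mkPlus, sndPlus_mkPlus, hinv']
  refine ⟨?_, fun h => ?_, fun e => ?_, ?_⟩
  · intro (u : HPlus (sumOp (block4 c.D₁ c.D₂) c.A₂))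
      (v : HPlus (sumOp (block4 c.D₁ c.D₂) c.A₂)) huv
    change pencil (sumD (block4 c.D₁ c.D₂) (bReal c.AA₂)) (sumF H₂ (proj4 E)) z u =
      pencil (sumD (block4 c.D₁ c.D₂) (bReal c.AA₂)) (sumF H₂ (proj4 E)) z v at huv
    rw [pencil_sum, pencil_sum, sumMinus_inj hB] at huv
    have h1 : fstPlus _ c.A₂ u = fstPlus _ c.A₂ v := by
      rw [← hinv (fstPlus _ c.A₂ u), huv.1, hinv]
    rw [← mkPlus_fst_snd hB u, ← mkPlus_fst_snd hB v, h1, c.pencil_injective hz huv.2]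
  · obtain ⟨_, -, hex⟩ := c.AA₂_extension.correct.exists_pencil_eq hz
    obtain ⟨u₂, hu₂, -⟩ := hex h.snd
    obtain ⟨u, hu⟩ := solve h.fst u₂
    exact ⟨u, hu.trans (by rw [hu₂]; rfl)⟩
  · obtain ⟨u₂, hu₂, -⟩ := c.transfer z hz e
    obtain ⟨u, hu⟩ := solve (c.column e) u₂
    exact ⟨u, hu.trans (by rw [hu₂]; rfl)⟩
  · obtain ⟨c₁, hc₁, hb₁⟩ := c.AA₂_extension.correct.norm_incl_le hz
    obtain ⟨c₂, hc₂, hb₂⟩ := sumMinus_bound hB (A₂ := c.A₂)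
    -- Here `c₂` bounds the components of a functional by its norm in `H₋`; the block inverse and
    -- the resolvent bound `c₁` then estimate the two components of `u`.
    refine ⟨‖block4Inv c.D₁Unit c.D₂Unit z‖ * c₂ + c₁ * c₂,
      fun (u : HPlus (sumOp (block4 c.D₁ c.D₂) c.A₂)) h e hu => ?_⟩
    rw [← hu]
    change ‖incl (sumOp (block4 c.D₁ c.D₂) c.A₂) u‖ ≤ _ *
      ‖pencil (sumD (block4 c.D₁ c.D₂) (bReal c.AA₂)) (sumF H₂ (proj4 E)) z u‖
    rw [pencil_sum]
    obtain ⟨hn₁, hn₂⟩ := hb₂ ((block4 c.D₁ c.D₂ - z • proj4 E) (fstPlus _ c.A₂ u))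
      (pencil (bReal c.AA₂) (ContinuousLinearMap.id ℂ H₂) z (sndPlus _ c.A₂ u))
    set n := ‖sumMinus (block4 c.D₁ c.D₂)
      ((block4 c.D₁ c.D₂ - z • proj4 E) (fstPlus _ c.A₂ u))
      (pencil (bReal c.AA₂) (ContinuousLinearMap.id ℂ H₂) z (sndPlus _ c.A₂ u))‖
    have e₁ : ‖fstPlus _ c.A₂ u‖ ≤ ‖block4Inv c.D₁Unit c.D₂Unit z‖ * (c₂ * n) := by
      calc _ = ‖block4Inv c.D₁Unit c.D₂Unit z
            ((block4 c.D₁ c.D₂ - z • proj4 E) (fstPlus _ c.A₂ u))‖ := by rw [hinv]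
        _ ≤ _ := (ContinuousLinearMap.le_opNorm _ _).trans (by gcongr)
    have e₂ : ‖incl c.A₂ (sndPlus _ c.A₂ u)‖ ≤ c₁ * (c₂ * n) :=
      (hb₁ _).trans (mul_le_mul_of_nonneg_left hn₂ hc₁)
    have e₃ : ‖incl (sumOp (block4 c.D₁ c.D₂) c.A₂) u‖ ^ 2 =
        ‖fstPlus _ c.A₂ u‖ ^ 2 + ‖incl c.A₂ (sndPlus _ c.A₂ u)‖ ^ 2 :=
      WithLp.prod_norm_sq_eq_of_L2 _
    have e₄ : ‖incl (sumOp (block4 c.D₁ c.D₂) c.A₂) u‖ ≤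
        ‖fstPlus _ c.A₂ u‖ + ‖incl c.A₂ (sndPlus _ c.A₂ u)‖ := by
      refine abs_le_of_sq_le_sq' ?_ (by positivity) |>.2
      nlinarith [mul_nonneg (norm_nonneg (fstPlus _ c.A₂ u))
        (norm_nonneg (incl c.A₂ (sndPlus _ c.A₂ u)))]
    linarith

lemma realizes (c : Construction R H₂) : c.system.Realizes V := by
  intro z hz
  have hB := c.isSelfAdjoint_block4
  refine ⟨c.mem_rho hz, fun e => ?_⟩
  obtain ⟨u₂, hu₂, -, hW⟩ := c.transfer z hz e
  have hinv' := block4_pencil_block4Inv c.D₁Unit c.D₂Unit z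
  rw [coe_D₁Unit, coe_D₂Unit] at hinv'
  have hu : pencil (sumD (block4 c.D₁ c.D₂) (bReal c.AA₂)) (sumF H₂ (proj4 E)) z
      (mkPlus hB c.A₂ (block4Inv c.D₁Unit c.D₂Unit z (c.column e), u₂)) =
        colK _ c.column c.K₂ e := by
    rw [pencil_sum, fstPlus_mkPlus, sndPlus_mkPlus, hinv', hu₂, colK_eq]
  refine ⟨_, hu, fun v hv => (c.mem_rho hz).1 (hv.trans hu.symm), ?_⟩
  refine ext_inner_right ℂ fun e' => ?_
  refine Eq.trans ?_ ((kAdjoint_inner (colK _ c.column c.K₂) _ e').trans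
    (sumMinus_mkPlus hB (c.column e') (c.K₂ e') _)).symm
  -- The two contributions are `z L + (Q - G)` and `V(z) - Q - z L + G`.
  rw [inner_block4Inv_column, ← kAdjoint_inner, ← hW, ← inner_add_left]
  congr 1
  simp only [add_apply, sub_apply, smul_apply]
  abel

lemma isDeltaPlus (c : Construction R H₂) : c.system.IsDeltaPlus where
  closed := sumOp_isClosed c.A₂_closed
  symmetric := sumOp_symmetric c.isSelfAdjoint_block4 c.A₂_symmetric
  biExtension := c.AA₂_extension.correct.sumD c.isSelfAdjoint_block4
  K_injective := by
    intro e e' h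
    change colK (block4 c.D₁ c.D₂) c.column c.K₂ e = colK _ c.column c.K₂ e' at h
    rw [colK_eq, colK_eq, sumMinus_inj c.isSelfAdjoint_block4] at h
    -- The invertible entry `K₁₁` alone makes the column injective, whatever `K₂` is.
    have h2 : (c.K₁₁ : E →L[ℂ] E) e = (c.K₁₁ : E →L[ℂ] E) e' := congrArg (fun w : E4 E => w 2) h.1
    rw [← unit_inv_apply_apply c.K₁₁ e, h2, unit_inv_apply_apply]
  F_projection := sumF_isSymmetricProjection proj4_isSymmetricProjection
  F_plus_projection := exists_plus_projection c.isSelfAdjoint_block4 c.A₂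
  rho_open := c.system.isOpen_rho

lemma isMinimal_iff (c : Construction R H₂) : c.system.IsMinimal ↔ IsPrime c.A₂ := by
  refine not_congr ⟨?_, ?_⟩
  · rintro ⟨M, N, -, hN, hMN, hM⟩
    have hF : ∀ x, sumF H₂ (proj4 E) (sumF H₂ (proj4 E) x) = sumF H₂ (proj4 E) x :=
      LinearMap.congr_fun (sumF_isSymmetricProjection proj4_isSymmetricProjection).isIdempotentElem
    have hMF : ∀ x ∈ M, sumF H₂ (proj4 E) x = x := by
      have hcl : IsClosed {x | sumF H₂ (proj4 E) x = x} :=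
        isClosed_eq (sumF H₂ (proj4 E)).continuous continuous_id
      intro x hx
      rw [hMN] at hx
      refine closure_minimal ?_ hcl hx
      rintro _ ⟨u, hu, rfl⟩
      obtain ⟨w, hw⟩ := hN u hu
      exact (congrArg (sumF H₂ (proj4 E)) hw).trans ((hF _).trans hw.symm)
    have hM0 := eq_zeroSum_of_le_range hMF hM
    rw [hM0] at hM
    exact ⟨_, (isSelfAdjointPart_zeroSum _ _ _).1 hM⟩
  · rintro ⟨M₂, hM₂⟩
    have hM := (isSelfAdjointPart_zeroSum (block4 c.D₁ c.D₂) c.A₂ M₂).2 hM₂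
    have hcl : IsClosed (zeroSum (E4 E) M₂ : Set (WithLp 2 (E4 E × H₂))) :=
      hM.isClosed
    -- The subspace of `H₊` is taken as large as possible, all of `H₊ ∩ (0 ⊕ M₂)`; it is fixed by
    -- `F₊`.
    refine ⟨zeroSum (E4 E) M₂, (zeroSum (E4 E) M₂).comap (incl c.system.A).toLinearMap,
      hcl.preimage (incl c.system.A).continuous, fun u hu => ⟨u, ?_⟩, le_antisymm ?_ ?_, hM⟩
    · refine (WithLp.equiv 2 (E4 E × H₂)).injective (Prod.ext ?_ rfl)
      have h0 : (incl (sumOp (block4 c.D₁ c.D₂) c.A₂) u).fst = 0 := (mem_zeroSum.1 hu).1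
      exact h0.trans ((congrArg (proj4 E) h0).trans (map_zero _)).symm
    · intro x hx
      have hd := hM.dense_domain ⟨x, hx⟩
      refine map_mem_closure continuous_subtype_val hd ?_
      rintro y ⟨hy, -⟩
      -- The domain of the induced operator is dense in `M`, and `A ⊂ 𝔻` places it in `H₊`, so the
      -- chosen subspace has closure `M`.
      obtain ⟨u, hu, -⟩ := c.isDeltaPlus.biExtension.extends_A ⟨_, hy⟩
      refine ⟨u, ?_, hu⟩
      change incl c.system.A u ∈ zeroSum (E4 E) M₂
      rw [hu]
      exact y.2
    · refine Submodule.topologicalClosure_minimal _ ?_ hcl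
      exact Submodule.map_comap_le _ _

end Construction

end System

end Impedance

end

theorem theorem5p2 {E : Type*} [NormedAddCommGroup E] [InnerProductSpace ℂ E]
    [FiniteDimensional ℂ E] [CompleteSpace E]
    {H₂ : Type*} [NormedAddCommGroup H₂] [InnerProductSpace ℂ H₂] [CompleteSpace H₂]
    (V : ℂ → E →L[ℂ] E) (hV : Impedance.IsHerglotzNevanlinna V)
    (R : Impedance.NevanlinnaRepresentation V) (c : Impedance.Construction R H₂) :
    c.system.IsDeltaPlus ∧ c.system.Realizes V ∧
      (c.system.IsMinimal ↔ Impedance.IsPrime c.A₂) :=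
  ⟨c.isDeltaPlus, c.realizes, c.isMinimal_iff⟩
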